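/- \textbf{Setting.} Let $t_1^*,\dots,t_n^*\in\mathbb{R}^3$ be distinct, and let $E\subseteq[n]\times[n]$ be the edge list of a graph $G$ on $[n]$ without loops, in which $ij$ and $ji$ are never both listed. Let $E=E_g\sqcup E_b$ be a partition into good and bad edges. Put $\gamma_{ij}^*=(t_i^*-t_j^*)/\|t_i^*-t_j^*\|$ for $i\ne j$. Each $ij\in E$ carries a unit vector $\gamma_{ij}$, with $\gamma_{ij}=\gamma_{ij}^*$ for $ij\in E_g$ and $\gamma_{ij}$ arbitrary for $ij\in E_b$. For a subspace $V$ let $P_V$ be the orthogonal projection onto $V$. For $ij\in E$ let $$f_{ij}(x,y)=\begin{cases}\|P_{\gamma_{ij}^\perp}(x-y)\|,&\langle\gamma_{ij},x-y\rangle>1,\\ \|x-y-\gamma_{ij}\|,&\langle\gamma_{ij},x-y\rangle\le1.\end{cases}$$ The LUD problem is to minimize $\sum_{ij\in E}f_{ij}(t_i,t_j)$ over all $\{t_i\}_{i=1}^n\subset\mathbb{R}^3$ with $\sum_i t_i=0$. The oracle problem is the same minimization restricted to families of the form $t_i=ct_i^*+t$ with $c\in\mathbb{R}$, $t\in\mathbb{R}^3$.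 Assume that the oracle problem has a solution $(c,t)=(c^*,t_s)$ and that $c^*$ is unique. Let $E_{gl}=\{ij\in E_g:\|t_i^*-t_j^*\|>1/c^*\}$ (read as $c^*\|t_i^*-t_j^*\|>1$) and $E_{gl}^c=E\setminus E_{gl}$. A finite set $A\subset\mathbb{R}^3$ is \emph{$c$-well-distributed with respect to} $(x,y)$ if $\frac1{|A|}\sum_{a\in A}\|P_{\mathrm{span}\{a-x,a-y\}^\perp}h\|\ge c\,\|P_{(x-y)^\perp}h\|$ for all $h\in\mathbb{R}^3$. The family $\{t_i^*\}$ is \emph{$c$-well-distributed along} a graph $H$ on $[n]$ if, for all $i\neq j$, the set of those $t_k^*$ for which $k$ is adjacent in $H$ to both $i$ and $j$ is $c$-well-distributed with respect to $(t_i^*,t_j^*)$. \textbf{Theorem.} Let $p,\beta,\epsilon_0,\epsilon_1,c_1\in(0,1]$ and $c_0\ge1$, and suppose that the following good-shape condition holds: \begin{enumerate} \item $G$ is $p$-typical: it is connected, every vertex has degree between $\frac12np$ and $2np$, and any two distinct vertices have between $\frac12np^2$ and $2np^2$ common neighbours; \item for every ordered pair $i\ne j$ there are at least $n-\epsilon_1n$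 indices $k\ne i,j$ with $1-\langle\gamma_{ij}^*,\gamma_{ik}^*\rangle\ge\beta^2$ and $1-\langle\gamma_{ij}^*,\gamma_{jk}^*\rangle\ge\beta^2$; \item $\|t_i^*-t_j^*\|\le c_0\mu$ for all $i\neq j$, where $\mu=\binom n2^{-1}\sum_{i<j}\|t_i^*-t_j^*\|$; \item every vertex is incident to at most $\epsilon_0n$ edges of $E_{gl}^c$; \item $\{t_i^*\}$ is $c_1$-well-distributed along $G$ and along the complete graph $K_n$; \item no three of the points $t_i^*$ are collinear. \end{enumerate} Suppose also that $$\epsilon_0\le\min\left\{\frac{\beta c_1p}{2^{22}c_0^3},\ \frac{\beta c_1^2p}{2^{20}c_0},\ \frac{c_1p^2}{16}\right\}\quad\text{and}\quad\epsilon_1\le\min\left\{\frac1{144c_0},\frac1{96}\right\}.$$ Then the good-long-dominance condition holds: for all $\varepsilon_1,\dots,\varepsilon_n\in\mathbb{R}^3$ with $\sum_i\varepsilon_i=0$ and $\sum_i\langle\varepsilon_i,t_i^*\rangle=0$, $$\sum_{ij\in E_{gl}}\|P_{\gamma_{ij}^{*\perp}}(\varepsilon_i-\varepsilon_j)\|\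 \ge\sum_{ij\in E_{gl}^c}\|\varepsilon_i-\varepsilon_j\|.$$ Moreover, the LUD problem has exactly one solution $\{\hat t_i\}_{i=1}^n$, namely $\hat t_i=c^*t_i^*+t_s$ for all $i\in[n]$. -/

import Mathlib

noncomputable section

namespace LUD

/-- Euclidean three-space. -/
abbrev E3 := EuclideanSpace ℝ (Fin 3)

/-- The vector `P_{γ^⊥} v`: orthogonal projection of `v` onto the orthogonal complement of `γ`. -/
def projPerp (γ v : E3) : E3 := ((Submodule.span ℝ {γ})ᗮ).starProjection v

/-- The true direction `(x - y) / ‖x - y‖` of the pair of locations `x`, `y`. -/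
def direction (x y : E3) : E3 := ‖x - y‖⁻¹ • (x - y)

/-- The undirected graph with an edge between `i` and `j` whenever `ij` or `ji` is listed in `E`. -/
def graphOf {n : ℕ} (E : Finset (Fin n × Fin n)) : SimpleGraph (Fin n) :=
  SimpleGraph.fromRel (fun i j => (i, j) ∈ E)

/-- The deterministic setting: distinct ground truth locations `t_i^*`; a list of edges
`E ⊆ [n] × [n]`, in which `ij` and `ji` are never both present (in particular there are no loops),
partitioned into good and bad edges; and a unit vector `γ_ij` for each edge `ij`, which is the true
direction on the good edges and arbitrary on the bad ones (values off `E` are never used). -/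
structure CameraNetwork (n : ℕ) where
  loc : Fin n → E3
  loc_injective : Function.Injective loc
  Eg : Finset (Fin n × Fin n)
  Eb : Finset (Fin n × Fin n)
  disjoint : Disjoint Eg Eb
  no_repetition : ∀ i j, (i, j) ∈ Eg ∪ Eb → (j, i) ∉ Eg ∪ Eb
  γ : Fin n → Fin n → E3
  norm_γ : ∀ i j, (i, j) ∈ Eg ∪ Eb → ‖γ i j‖ = 1
  γ_good : ∀ i j, (i, j) ∈ Eg → γ i j = direction (loc i) (loc j)

/-! ### The LUD problem and the oracle problem -/

open Classical in
/-- The summand `f_ij(x, y)`, as a function of `γ = γ_ij`. -/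
def edgeCost (γ x y : E3) : ℝ :=
  if 1 < inner ℝ γ (x - y) then ‖projPerp γ (x - y)‖ else ‖x - y - γ‖

namespace CameraNetwork

variable {n : ℕ} (N : CameraNetwork n)

/-- All the edges. -/
def E : Finset (Fin n × Fin n) := N.Eg ∪ N.Eb

/-- The true direction `γ_ij^*`. -/
def γstar (i j : Fin n) : E3 := direction (N.loc i) (N.loc j)

/-- The objective function of LUD, with the auxiliary variables eliminated. -/
def objective (t : Fin n → E3) : ℝ := ∑ e ∈ N.E, edgeCost (N.γ e.1 e.2) (t e.1) (t e.2)

/-- `t` solves LUD: it minimizes the objective among the centred families of locations. -/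
def IsLUDSolution (t : Fin n → E3) : Prop :=
  ∑ i, t i = 0 ∧ ∀ u : Fin n → E3, ∑ i, u i = 0 → N.objective t ≤ N.objective u

/-- `(c, s)` solves the oracle problem: it minimizes the objective among the centred families of
the form `c t_i^* + s`, where `c` is any real number and `s` any vector. -/
def IsOracleSolution (c : ℝ) (s : E3) : Prop :=
  ∑ i, (c • N.loc i + s) = 0 ∧
    ∀ (c' : ℝ) (s' : E3), ∑ i, (c' • N.loc i + s') = 0 →
      N.objective (fun i => c • N.loc i + s) ≤ N.objective (fun i => c' • N.loc i + s')

/-! ### Good and long edges, and the good-long-dominance condition -/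

open Classical in
/-- The good and long edges with respect to the scale `c`: those `ij ∈ E_g` with
`‖t_i^* - t_j^*‖ > 1 / c`. (The product form also forces `c > 0`.) -/
def Egl (c : ℝ) : Finset (Fin n × Fin n) :=
  N.Eg.filter (fun e => 1 < c * ‖N.loc e.1 - N.loc e.2‖)

/-- The complement of the good and long edges within `E`. -/
def EglCompl (c : ℝ) : Finset (Fin n × Fin n) := N.E \ N.Egl c

/-- The good-long-dominance condition. -/
def GoodLongDominance (c : ℝ) : Prop :=
  ∀ ε : Fin n → E3, ∑ i, ε i = 0 → ∑ i, inner ℝ (ε i) (N.loc i) = 0 →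
    ∑ e ∈ N.EglCompl c, ‖ε e.1 - ε e.2‖ ≤
      ∑ e ∈ N.Egl c, ‖projPerp (N.γstar e.1 e.2) (ε e.1 - ε e.2)‖

end CameraNetwork

/-! ### The good-shape condition -/

/-- `p`-typical graphs on `n` vertices. -/
structure IsTypical {n : ℕ} (G : SimpleGraph (Fin n)) (p : ℝ) : Prop where
  connected : G.Connected
  degree : ∀ i, (1 / 2) * n * p ≤ ((G.neighborSet i).ncard : ℝ) ∧
    ((G.neighborSet i).ncard : ℝ) ≤ 2 * n * p
  codegree : ∀ i j, i ≠ j → (1 / 2) * n * p ^ 2 ≤ ((G.commonNeighbors i j).ncard : ℝ) ∧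
    ((G.commonNeighbors i j).ncard : ℝ) ≤ 2 * n * p ^ 2

/-- The finite set `A` of points is `c`-well-distributed with respect to `(x, y)`. -/
def IsWellDistributed (c : ℝ) (A : Finset E3) (x y : E3) : Prop :=
  ∀ h : E3, c * ‖projPerp (x - y) h‖ ≤
    (1 / (A.card : ℝ)) *
      ∑ a ∈ A, ‖((Submodule.span ℝ {a - x, a - y})ᗮ).starProjection h‖

open Classical in
/-- The family `t` of locations is `c`-well-distributed along the graph `G`. -/
def IsWellDistributedAlong {n : ℕ} (c : ℝ) (t : Fin n → E3) (G : SimpleGraph (Fin n)) : Prop :=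
  ∀ i j, i ≠ j →
    IsWellDistributed c
      ((Finset.univ.filter (fun k => G.Adj i k ∧ G.Adj j k)).image t) (t i) (t j)

/-- The mean distance `μ` over the edges of the complete graph. -/
def meanDist {n : ℕ} (t : Fin n → E3) : ℝ :=
  (∑ e ∈ Finset.univ.filter (fun e : Fin n × Fin n => e.1 < e.2), ‖t e.1 - t e.2‖) /
    (n.choose 2 : ℝ)

/-- The good-shape condition with the parameters `p, β, ε₀, ε₁, c₀, c₁`, where the good and long
edges are taken with respect to the scale `c`. -/
structure GoodShape {n : ℕ} (N : CameraNetwork n) (c p β ε₀ ε₁ c₀ c₁ : ℝ) : Prop where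
  typical : IsTypical (graphOf N.E) p
  large_angles : ∀ i j, i ≠ j →
    (n : ℝ) - ε₁ * n ≤
      (({k | k ≠ i ∧ k ≠ j ∧ β ^ 2 ≤ 1 - inner ℝ (N.γstar i j) (N.γstar i k) ∧
        β ^ 2 ≤ 1 - inner ℝ (N.γstar i j) (N.γstar j k)} : Set (Fin n)).ncard : ℝ)
  dist_le : ∀ i j, i ≠ j → ‖N.loc i - N.loc j‖ ≤ c₀ * meanDist N.loc
  max_degree : ∀ i, (((graphOf (N.EglCompl c)).neighborSet i).ncard : ℝ) ≤ ε₀ * n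
  well_distributed : IsWellDistributedAlong c₁ N.loc (graphOf N.E)
  well_distributed_complete : IsWellDistributedAlong c₁ N.loc (⊤ : SimpleGraph (Fin n))
  not_collinear : ∀ i j k, i ≠ j → i ≠ k → j ≠ k →
    ¬ Collinear ℝ ({N.loc i, N.loc j, N.loc k} : Set E3)

end LUD

end

noncomputable section

namespace LUD

/-! ### Orthogonal projections -/

/-! Minimality and uniqueness follow from a perturbation argument. The difference between a
competitor and the oracle point is a dilation plus a translation plus a motion `ε` orthogonal to
both (`exists_dilation_add`). Each cost is the distance from `x - y` to the ray of multiples `α •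
γ`, `α ≥ 1`, hence convex and 1-Lipschitz. After a small step towards the competitor, good long
edges pay exactly their perpendicular motion, while every other edge saves at most `‖ε i - ε j‖`
times the step. Strict dominance thus puts the objective above that of a member of the oracle
family, and convexity carries the inequality to the competitor (`oracle_lt_of_strictDominance`).
Uniqueness of the scale is needed only when `ε = 0`.

For dominance, split `ε i - ε j` into a part `η` perpendicular to `t i - t j` and a parallel part
with relative stretching `δ`. Well-distribution bounds `η` of a pair by its values along paths of
length two, so `η` on the sparse graph of bad or short edges is a small part of `η` on all edges
(`sum_edges_le_of_wellDistributed`).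

For the stretching, two sides of a nondegenerate triangle have the same `δ` up to the `η` of its
three sides (`triangle_stretch_le`). Chains of two triangles compare most pairs with the median `δ`
of the long pairs (`exists_reference`); orthogonality to the locations makes that median small
(`sum_dev_zero_le`), and sparsity makes the stretching on the exceptional edges small
(`sum_dev_sparse_le`). The constants are balanced in `strictDominance_of_goodShape`. -/

lemma projPerp_eq (γ v : E3) : projPerp γ v = v - (inner ℝ γ v / ‖γ‖ ^ 2) • γ := by
  rw [projPerp, Submodule.starProjection_orthogonal_val, Submodule.starProjection_singleton]
  simp

lemma projPerp_add (γ v w : E3) : projPerp γ (v + w) = projPerp γ v + projPerp γ w :=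
  map_add _ _ _

lemma projPerp_sub (γ v w : E3) : projPerp γ (v - w) = projPerp γ v - projPerp γ w :=
  map_sub _ _ _

lemma projPerp_smul (γ v : E3) (r : ℝ) : projPerp γ (r • v) = r • projPerp γ v :=
  map_smul _ _ _

lemma projPerp_neg (γ v : E3) : projPerp γ (-v) = -projPerp γ v :=
  map_neg _ _

lemma projPerp_zero (γ : E3) : projPerp γ 0 = 0 := map_zero _

lemma norm_projPerp_le (γ v : E3) : ‖projPerp γ v‖ ≤ ‖v‖ :=
  Submodule.norm_starProjection_apply_le _ _

lemma projPerp_smul_left {r : ℝ} (hr : r ≠ 0) (γ v : E3) :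
    projPerp (r • γ) v = projPerp γ v := by
  unfold projPerp
  congr! 2
  exact congrArg _ (Submodule.span_singleton_smul_eq (IsUnit.mk0 r hr) γ)

lemma projPerp_neg_left (γ v : E3) : projPerp (-γ) v = projPerp γ v := by
  rw [← neg_one_smul ℝ γ, projPerp_smul_left (by norm_num)]

lemma projPerp_self (γ : E3) : projPerp γ γ = 0 :=
  Submodule.starProjection_orthogonalComplement_singleton_eq_zero γ

lemma projPerp_smul_self (γ : E3) (r : ℝ) : projPerp γ (r • γ) = 0 := by
  rw [projPerp_smul, projPerp_self, smul_zero]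

lemma projPerp_direction {x y : E3} (h : x ≠ y) (v : E3) :
    projPerp (direction x y) v = projPerp (x - y) v :=
  projPerp_smul_left (inv_ne_zero (norm_ne_zero_iff.2 (sub_ne_zero.2 h))) _ _

lemma norm_starProjection_orthogonal_le_of_le {U V : Submodule ℝ E3} (h : U ≤ V) (v : E3) :
    ‖Vᗮ.starProjection v‖ ≤ ‖Uᗮ.starProjection v‖ := by
  have := Submodule.starProjection_comp_starProjection_of_le (Submodule.orthogonal_le h)
  rw [← this]
  exact Submodule.norm_starProjection_apply_le _ _

lemma norm_direction {x y : E3} (h : x ≠ y) : ‖direction x y‖ = 1 := by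
  have := norm_ne_zero_iff.2 (sub_ne_zero.2 h)
  rw [direction, norm_smul, norm_inv, norm_norm, inv_mul_cancel₀ this]

lemma direction_swap (x y : E3) : direction y x = -direction x y := by
  rw [direction, direction, norm_sub_rev, ← smul_neg, neg_sub]

lemma norm_smul_direction {x y : E3} (h : x ≠ y) : ‖x - y‖ • direction x y = x - y := by
  have := norm_ne_zero_iff.2 (sub_ne_zero.2 h)
  rw [direction, smul_inv_smul₀ this]

lemma norm_sq_projPerp {γ : E3} (hγ : ‖γ‖ = 1) (v : E3) :
    ‖projPerp γ v‖ ^ 2 = ‖v‖ ^ 2 - (inner ℝ γ v) ^ 2 := by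
  rw [projPerp_eq, hγ, norm_sub_sq_real, inner_smul_right, norm_smul, hγ, real_inner_comm,
    Real.norm_eq_abs, mul_one, sq_abs]
  ring

/-- Motion in the plane of a triangle `x, y, z`: comparison of the relative stretching of two sides
with the non-parallel parts of the motion of all three sides. -/
lemma triangle_stretch_le {a b : E3} {δ₁ δ₂ δ₃ η₁ η₂ η₃ : ℝ} {x y : E3}
    (h₁ : ‖x - δ₁ • a‖ ≤ η₁) (h₂ : ‖y - δ₂ • b‖ ≤ η₂) (h₃ : ‖(y - x) - δ₃ • (b - a)‖ ≤ η₃) :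
    |δ₁ - δ₂| * ‖projPerp (b - a) a‖ ≤ η₁ + η₃ + η₂ := by
  have key : (δ₁ - δ₂) • a
      = ((y - δ₂ • b) - (x - δ₁ • a) - ((y - x) - δ₃ • (b - a))) - (δ₃ - δ₂) • (b - a) := by
    module
  -- Projecting off the third side eliminates `δ₃`.
  have h := congrArg (projPerp (b - a)) key
  rw [projPerp_smul, projPerp_sub, projPerp_smul_self, sub_zero] at h
  calc |δ₁ - δ₂| * ‖projPerp (b - a) a‖ = ‖(δ₁ - δ₂) • projPerp (b - a) a‖ := by
        rw [norm_smul, Real.norm_eq_abs]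
    _ ≤ ‖(y - δ₂ • b) - (x - δ₁ • a) - ((y - x) - δ₃ • (b - a))‖ := by
        rw [h]; exact norm_projPerp_le _ _
    _ ≤ ‖(y - δ₂ • b)‖ + ‖(x - δ₁ • a)‖ + ‖((y - x) - δ₃ • (b - a))‖ :=
        (norm_sub_le _ _).trans (by gcongr; exact norm_sub_le _ _)
    _ ≤ η₁ + η₃ + η₂ := by linarith

/-! ### The summands of the objective function -/

/-- With `exists_edgeCost_eq`, this identifies the cost as the distance from `x - y` to the ray of
multiples `α • γ`, `α ≥ 1`; the Lipschitz bound and convexity below use nothing else. -/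
lemma edgeCost_le {γ : E3} (hγ : ‖γ‖ = 1) (x y : E3) {α : ℝ} (hα : 1 ≤ α) :
    edgeCost γ x y ≤ ‖x - y - α • γ‖ := by
  unfold edgeCost
  split_ifs with h
  · calc ‖projPerp γ (x - y)‖ = ‖projPerp γ (x - y - α • γ)‖ := by
          rw [projPerp_sub γ (x - y), projPerp_smul_self, sub_zero]
      _ ≤ _ := norm_projPerp_le _ _
  · rw [← sq_le_sq₀ (norm_nonneg _) (norm_nonneg _), norm_sub_sq_real (x - y),
      norm_sub_sq_real (x - y), inner_smul_right, norm_smul, hγ, real_inner_comm, Real.norm_eq_abs, mul_one, sq_abs]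
    -- The squared distance is quadratic in `α` with its minimum at the inner product, which is at
    -- most 1, so it is nondecreasing for `α ≥ 1`.
    nlinarith

lemma exists_edgeCost_eq {γ : E3} (hγ : ‖γ‖ = 1) (x y : E3) :
    ∃ α : ℝ, 1 ≤ α ∧ edgeCost γ x y = ‖x - y - α • γ‖ := by
  unfold edgeCost
  split_ifs with h
  · exact ⟨inner ℝ γ (x - y), h.le, by rw [projPerp_eq, hγ]; simp⟩
  · exact ⟨1, le_rfl, by simp⟩

lemma edgeCost_le_add {γ : E3} (hγ : ‖γ‖ = 1) (x y x' y' : E3) :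
    edgeCost γ x y ≤ edgeCost γ x' y' + ‖(x - y) - (x' - y')‖ := by
  obtain ⟨α, hα, h⟩ := exists_edgeCost_eq hγ x' y'
  refine (edgeCost_le hγ x y hα).trans ?_
  rw [h, add_comm]
  have : x - y - α • γ = ((x - y) - (x' - y')) + (x' - y' - α • γ) := by abel
  rw [this]
  exact norm_add_le _ _

lemma edgeCost_convex {γ : E3} (hγ : ‖γ‖ = 1) (x y x' y' : E3) {τ : ℝ} (h0 : 0 ≤ τ)
    (h1 : τ ≤ 1) :
    edgeCost γ (x + τ • (x' - x)) (y + τ • (y' - y))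
      ≤ (1 - τ) * edgeCost γ x y + τ * edgeCost γ x' y' := by
  obtain ⟨α, hα, h⟩ := exists_edgeCost_eq hγ x y
  obtain ⟨α', hα', h'⟩ := exists_edgeCost_eq hγ x' y'
  have hge : 1 ≤ (1 - τ) * α + τ * α' := by nlinarith
  refine (edgeCost_le hγ _ _ hge).trans ?_
  rw [h, h']
  have : x + τ • (x' - x) - (y + τ • (y' - y)) - ((1 - τ) * α + τ * α') • γ
      = (1 - τ) • (x - y - α • γ) + τ • (x' - y' - α' • γ) := by module
  rw [this]
  refine (norm_add_le _ _).trans ?_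
  rw [norm_smul, norm_smul, Real.norm_of_nonneg h0, Real.norm_of_nonneg (sub_nonneg.2 h1)]

/-! ### Strict dominance makes the oracle point the unique minimizer. -/

namespace CameraNetwork

variable {n : ℕ} (N : CameraNetwork n)

lemma objective_convex (t u : Fin n → E3) {τ : ℝ} (h0 : 0 ≤ τ) (h1 : τ ≤ 1) :
    N.objective (fun i => t i + τ • (u i - t i))
      ≤ (1 - τ) * N.objective t + τ * N.objective u := by
  unfold objective
  rw [Finset.mul_sum, Finset.mul_sum, ← Finset.sum_add_distrib]
  exact Finset.sum_le_sum fun e he => edgeCost_convex (N.norm_γ e.1 e.2 he) _ _ _ _ h0 h1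

lemma Egl_subset (c : ℝ) : N.Egl c ⊆ N.E := by
  classical
  exact (Finset.filter_subset _ _).trans Finset.subset_union_left

lemma sum_E (c : ℝ) (f : Fin n × Fin n → ℝ) :
    ∑ e ∈ N.E, f e = ∑ e ∈ N.EglCompl c, f e + ∑ e ∈ N.Egl c, f e :=
  (Finset.sum_sdiff (N.Egl_subset c)).symm

lemma mem_Egl {c : ℝ} {e : Fin n × Fin n} :
    e ∈ N.Egl c ↔ e ∈ N.Eg ∧ 1 < c * ‖N.loc e.1 - N.loc e.2‖ := by
  classical
  exact Finset.mem_filter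

lemma ne_of_mem_E {e : Fin n × Fin n} (he : e ∈ N.E) : e.1 ≠ e.2 := by
  intro h
  have h2 := N.no_repetition e.1 e.2 he
  rw [← h] at h2
  have : (e.1, e.1) = e := Prod.ext rfl h
  rw [this] at h2
  exact h2 he

lemma γ_eq_of_mem_Egl {c : ℝ} {e : Fin n × Fin n} (he : e ∈ N.Egl c) :
    N.γ e.1 e.2 = N.γstar e.1 e.2 :=
  N.γ_good _ _ (N.mem_Egl.1 he).1

lemma loc_ne {i j : Fin n} (h : i ≠ j) : N.loc i ≠ N.loc j := fun h' => h (N.loc_injective h')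

/-- Strict version of the good-long-dominance condition. -/
def StrictDominance (c : ℝ) : Prop :=
  ∀ ε : Fin n → E3, ∑ i, ε i = 0 → ∑ i, inner ℝ (ε i) (N.loc i) = 0 → ε ≠ 0 →
    ∑ e ∈ N.EglCompl c, ‖ε e.1 - ε e.2‖ <
      ∑ e ∈ N.Egl c, ‖projPerp (N.γstar e.1 e.2) (ε e.1 - ε e.2)‖

lemma StrictDominance.goodLongDominance {c : ℝ} (h : N.StrictDominance c) :
    N.GoodLongDominance c := by
  intro ε h1 h2
  by_cases h0 : ε = 0
  · subst h0
    simp [projPerp_zero]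
  · exact (h ε h1 h2 h0).le

/-- Every centred motion splits into a dilation about the centroid and a motion that is orthogonal
to the family of locations. -/
lemma exists_dilation_add (w : Fin n → E3) (hw : ∑ i, w i = 0) :
    ∃ (a : ℝ) (b : E3) (ε : Fin n → E3), (∀ i, w i = a • N.loc i + b + ε i) ∧
      ∑ i, ε i = 0 ∧ ∑ i, inner ℝ (ε i) (N.loc i) = 0 ∧ ∑ i, (a • N.loc i + b) = 0 := by
  set m : E3 := (n : ℝ)⁻¹ • ∑ i, N.loc i with hm
  have hy : ∑ i, (N.loc i - m) = 0 := by
    rcases Nat.eq_zero_or_pos n with h | h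
    · subst h; simp
    · have : (n : ℝ) ≠ 0 := by positivity
      rw [Finset.sum_sub_distrib, Finset.sum_const, Finset.card_univ, Fintype.card_fin,
        ← Nat.cast_smul_eq_nsmul ℝ, hm, smul_inv_smul₀ this, sub_self]
  have hyy : ∑ i, inner ℝ (N.loc i - m) (N.loc i) = ∑ i, ‖N.loc i - m‖ ^ 2 := by
    have h1 : ∑ i, inner ℝ (N.loc i - m) m = (0 : ℝ) := by
      rw [← sum_inner, hy, inner_zero_left]
    rw [← sub_eq_zero, ← Finset.sum_sub_distrib, ← h1]
    refine Finset.sum_congr rfl fun i _ => ?_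
    rw [← real_inner_self_eq_norm_sq, ← inner_sub_right]
    congr 1; abel
  set Q : ℝ := ∑ i, ‖N.loc i - m‖ ^ 2 with hQ
  set a : ℝ := (∑ i, inner ℝ (w i) (N.loc i)) / Q with ha
  have haQ : a * Q = ∑ i, inner ℝ (w i) (N.loc i) := by
    -- If `Q = 0`, all locations coincide with the centroid and both sides vanish.
    by_cases hQ0 : Q = 0
    · have h2 : ∀ i, N.loc i = m := by
        intro i
        have := (Finset.sum_eq_zero_iff_of_nonneg (fun i _ => by positivity)).1 hQ0 i
          (Finset.mem_univ i)
        exact sub_eq_zero.1 (norm_eq_zero.1 (pow_eq_zero_iff (two_ne_zero)|>.1 this))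
      simp_rw [h2]
      rw [← sum_inner, hw, inner_zero_left, hQ0, mul_zero]
    · rw [ha, div_mul_cancel₀ _ hQ0]
  refine ⟨a, -(a • m), fun i => w i - a • (N.loc i - m), fun i => ?_, ?_, ?_, ?_⟩
  · module
  · rw [Finset.sum_sub_distrib, hw, ← Finset.smul_sum, hy, smul_zero, sub_zero]
  · simp_rw [inner_sub_left _ (a • _), real_inner_smul_left]
    rw [Finset.sum_sub_distrib, ← Finset.mul_sum, hyy, haQ, sub_self]
  · have : ∀ i, a • N.loc i + -(a • m) = a • (N.loc i - m) := fun i => by module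
    simp_rw [this]
    rw [← Finset.smul_sum, hy, smul_zero]

/-- At `τ = 0` the inner product is `c` times the length of the edge, which exceeds 1; the strict
inequality persists by continuity. -/
lemma eventually_long (c a : ℝ) (ε : Fin n → E3) :
    ∀ᶠ τ : ℝ in nhdsWithin 0 (Set.Ioi 0), ∀ e ∈ N.Egl c,
      1 < inner ℝ (N.γ e.1 e.2)
        ((c + τ * a) • (N.loc e.1 - N.loc e.2) + τ • (ε e.1 - ε e.2)) := by
  refine Filter.Eventually.filter_mono nhdsWithin_le_nhds ?_
  rw [Filter.eventually_all_finset]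
  intro e he
  have hc : Continuous fun τ : ℝ => (inner ℝ (N.γ e.1 e.2)
        ((c + τ * a) • (N.loc e.1 - N.loc e.2) + τ • (ε e.1 - ε e.2)) : ℝ) := by fun_prop
  refine hc.continuousAt.eventually (lt_mem_nhds ?_)
  have hne := N.loc_ne (N.ne_of_mem_E (N.Egl_subset c he))
  rw [N.γ_eq_of_mem_Egl he, γstar]
  simp only [zero_mul, add_zero, zero_smul]
  rw [← norm_smul_direction hne, smul_smul, inner_smul_right, real_inner_self_eq_norm_sq,
    norm_direction hne]
  simpa using (N.mem_Egl.1 he).2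

lemma oracle_lt_of_strictDominance {c : ℝ} {s : E3} (hcs : N.IsOracleSolution c s)
    (hunique : ∀ (c' : ℝ) (s' : E3), N.IsOracleSolution c' s' → c' = c)
    (hdom : N.StrictDominance c) (u : Fin n → E3) (hu : ∑ i, u i = 0)
    (hne : u ≠ fun i => c • N.loc i + s) :
    N.objective (fun i => c • N.loc i + s) < N.objective u := by
  obtain ⟨a, b, ε, hw, hε, hεl, hab⟩ := N.exists_dilation_add (fun i => u i - (c • N.loc i + s))
    (by rw [Finset.sum_sub_distrib, hu, hcs.1, sub_zero])
  have hsum : ∀ τ : ℝ, ∑ i, ((c + τ * a) • N.loc i + (s + τ • b)) = 0 := by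
    intro τ
    have : ∀ i, (c + τ * a) • N.loc i + (s + τ • b)
        = (c • N.loc i + s) + τ • (a • N.loc i + b) := fun i => by module
    simp_rw [this]
    rw [Finset.sum_add_distrib, hcs.1, ← Finset.smul_sum, hab, smul_zero, add_zero]
  by_cases hε0 : ε = 0
  · have hu' : u = fun i => (c + a) • N.loc i + (s + b) := by
      funext i
      have := hw i
      rw [hε0, Pi.zero_apply, add_zero, sub_eq_iff_eq_add] at this
      rw [this]; module
    have h1 := hsum 1
    simp only [one_mul, one_smul] at h1
    refine lt_of_le_of_ne (hu' ▸ hcs.2 _ _ h1) fun heq => hne ?_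
    have hsol : N.IsOracleSolution (c + a) (s + b) :=
      ⟨h1, fun c' s' h' => by rw [← hu', ← heq]; exact hcs.2 c' s' h'⟩
    -- With `ε = 0` the competitor lies in the oracle family; were its objective equal, its scale
    -- would have to be `c`, and centring then fixes the shift.
    have ha : a = 0 := by linarith [hunique _ _ hsol]
    have hn : n ≠ 0 := by
      rintro rfl
      exact hne (Subsingleton.elim _ _)
    have hb : b = 0 := by
      rw [ha] at hab
      simp only [zero_smul, zero_add, Finset.sum_const, Finset.card_univ, Fintype.card_fin] at hab
      rw [← Nat.cast_smul_eq_nsmul ℝ] at hab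
      exact (smul_eq_zero.1 hab).resolve_left (Nat.cast_ne_zero.2 hn)
    rw [hu', ha, hb, add_zero, add_zero]
  -- The step `τ` keeps good long edges in the projection regime both with and without `ε`.
  · have hev := ((N.eventually_long c a ε).and (N.eventually_long c a 0)).and
      (Ioo_mem_nhdsGT (show (0 : ℝ) < 1 by norm_num))
    obtain ⟨τ, ⟨hlong, hlong'⟩, hτ0, hτ1⟩ := hev.exists
    have hconv := N.objective_convex (fun i => c • N.loc i + s) u hτ0.le hτ1.le
    have horacle := hcs.2 _ _ (hsum τ)
    have hlt : N.objective (fun i => (c + τ * a) • N.loc i + (s + τ • b)) <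
        N.objective (fun i => c • N.loc i + s + τ • (u i - (c • N.loc i + s))) := by
      have hform : ∀ i, c • N.loc i + s + τ • (u i - (c • N.loc i + s))
          = (c + τ * a) • N.loc i + (s + τ • b) + τ • ε i := by
        intro i; rw [hw i]; module
      simp_rw [hform]
      unfold objective
      rw [N.sum_E c, N.sum_E c]
      -- On the remaining edges only the Lipschitz bound is available.
      have hbad : ∑ e ∈ N.EglCompl c, edgeCost (N.γ e.1 e.2)
            ((c + τ * a) • N.loc e.1 + (s + τ • b)) ((c + τ * a) • N.loc e.2 + (s + τ • b)) ≤
          ∑ e ∈ N.EglCompl c, edgeCost (N.γ e.1 e.2)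
            ((c + τ * a) • N.loc e.1 + (s + τ • b) + τ • ε e.1)
            ((c + τ * a) • N.loc e.2 + (s + τ • b) + τ • ε e.2) +
          τ * ∑ e ∈ N.EglCompl c, ‖ε e.1 - ε e.2‖ := by
        rw [Finset.mul_sum, ← Finset.sum_add_distrib]
        refine Finset.sum_le_sum fun e he => ?_
        refine (edgeCost_le_add (N.norm_γ e.1 e.2 (Finset.sdiff_subset he)) _ _ _ _).trans
          (add_le_add le_rfl (le_of_eq ?_))
        rw [← Real.norm_of_nonneg hτ0.le, ← norm_smul, Real.norm_of_nonneg hτ0.le, ← norm_neg]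
        congr 1; module
      -- The dilated oracle is parallel to the true direction and costs nothing; adding `ε` costs
      -- exactly its projection.
      have hgood : ∀ e ∈ N.Egl c, edgeCost (N.γ e.1 e.2)
            ((c + τ * a) • N.loc e.1 + (s + τ • b)) ((c + τ * a) • N.loc e.2 + (s + τ • b))
            ≤ 0 ∧ edgeCost (N.γ e.1 e.2)
            ((c + τ * a) • N.loc e.1 + (s + τ • b) + τ • ε e.1)
            ((c + τ * a) • N.loc e.2 + (s + τ • b) + τ • ε e.2) =
            τ * ‖projPerp (N.γstar e.1 e.2) (ε e.1 - ε e.2)‖ := by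
        intro e he
        have hne := N.loc_ne (N.ne_of_mem_E (N.Egl_subset c he))
        have h0 := hlong' e he
        have h1 := hlong e he
        have e0 : (c + τ * a) • N.loc e.1 + (s + τ • b) - ((c + τ * a) • N.loc e.2 + (s + τ • b))
            = (c + τ * a) • (N.loc e.1 - N.loc e.2) := by module
        have e1 : (c + τ * a) • N.loc e.1 + (s + τ • b) + τ • ε e.1
              - ((c + τ * a) • N.loc e.2 + (s + τ • b) + τ • ε e.2)
            = (c + τ * a) • (N.loc e.1 - N.loc e.2) + τ • (ε e.1 - ε e.2) := by module
        have hz : projPerp (N.γ e.1 e.2) ((c + τ * a) • (N.loc e.1 - N.loc e.2)) = 0 := by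
          rw [N.γ_eq_of_mem_Egl he, γstar, projPerp_direction hne, projPerp_smul_self]
        unfold edgeCost
        rw [e0, e1, if_pos h1, if_pos (by simpa using h0), hz, projPerp_add, hz, zero_add,
          projPerp_smul, norm_smul, Real.norm_of_nonneg hτ0.le, N.γ_eq_of_mem_Egl he]
        exact ⟨norm_zero.le, rfl⟩
      have hg1 := Finset.sum_nonpos fun e he => (hgood e he).1
      have hg2 := Finset.sum_congr rfl fun e he => (hgood e he).2
      rw [hg2, ← Finset.mul_sum]
      have := mul_lt_mul_of_pos_left (hdom ε hε hεl hε0) hτ0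
      linarith
    have h := horacle.trans_lt (hlt.trans_le hconv)
    nlinarith

end CameraNetwork

/-! ### Medians of finite families. -/

open Classical in
lemma exists_median {α : Type*} (L : Finset α) (f : α → ℝ) :
    ∃ r : ℝ, L.card ≤ 2 * (L.filter (fun a => f a ≤ r)).card ∧
      L.card ≤ 2 * (L.filter (fun a => r ≤ f a)).card := by
  rcases L.eq_empty_or_nonempty with rfl | hL
  · exact ⟨0, by simp⟩
  -- The median is the least value with half of `L` at or below it. If fewer than half lay at or
  -- above it, the largest value strictly below it would qualify too.
  set S := L.filter (fun a => L.card ≤ 2 * (L.filter (fun b => f b ≤ f a)).card) with hS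
  have hSne : S.Nonempty := by
    obtain ⟨a, ha, hmax⟩ := L.exists_max_image f hL
    refine ⟨a, Finset.mem_filter.2 ⟨ha, ?_⟩⟩
    rw [Finset.filter_true_of_mem hmax]
    omega
  obtain ⟨a, ha, hmin⟩ := S.exists_min_image f hSne
  refine ⟨f a, (Finset.mem_filter.1 ha).2, ?_⟩
  by_contra! hlt
  have hsplit := Finset.card_filter_add_card_filter_not (s := L) (fun b => f a ≤ f b)
  have hpos : 0 < (L.filter (fun b => ¬ f a ≤ f b)).card := by omega
  obtain ⟨b, hb, hmax⟩ := (L.filter (fun b => ¬ f a ≤ f b)).exists_max_image f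
    (Finset.card_pos.1 hpos)
  have hb' := Finset.mem_filter.1 hb
  refine hb'.2 (hmin b (Finset.mem_filter.2 ⟨hb'.1, ?_⟩))
  have hsub : L.filter (fun b => ¬ f a ≤ f b) ⊆ L.filter (fun b' => f b' ≤ f b) :=
    fun x hx => Finset.mem_filter.2 ⟨(Finset.mem_filter.1 hx).1, hmax x hx⟩
  have := Finset.card_le_card hsub
  omega

-- At least half of `L` lies on the side of `r` away from `y`, and `G` has at least two thirds of
-- `L`; they share a sixth of `L`, on which `|y - f a|` is at least `|y - r|`.
open Classical in
lemma card_mul_abs_sub_median_le {α : Type*} {L G : Finset α} {f : α → ℝ} {r : ℝ} (hG : G ⊆ L)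
    (hcard : 2 * L.card ≤ 3 * G.card)
    (h1 : L.card ≤ 2 * (L.filter (fun a => f a ≤ r)).card)
    (h2 : L.card ≤ 2 * (L.filter (fun a => r ≤ f a)).card) (y : ℝ) :
    L.card * |y - r| ≤ 6 * ∑ a ∈ G, |y - f a| := by
  have key : ∀ P : α → Prop, L.card ≤ 2 * (L.filter P).card →
      (∀ a, P a → |y - r| ≤ |y - f a|) → L.card * |y - r| ≤ 6 * ∑ a ∈ G, |y - f a| := by
    intro P hP hle
    have hun : (L.filter P ∪ G).card ≤ L.card :=
      Finset.card_le_card (Finset.union_subset (Finset.filter_subset _ _) hG)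
    have hie := Finset.card_union_add_card_inter (L.filter P) G
    have hnat : L.card ≤ 6 * (L.filter P ∩ G).card := by omega
    have hcast : (L.card : ℝ) ≤ 6 * ((L.filter P ∩ G).card : ℝ) := by exact_mod_cast hnat
    calc L.card * |y - r| ≤ 6 * ((L.filter P ∩ G).card : ℝ) * |y - r| := by gcongr
      _ = 6 * ∑ a ∈ L.filter P ∩ G, |y - r| := by
          rw [Finset.sum_const, nsmul_eq_mul]; ring
      _ ≤ 6 * ∑ a ∈ L.filter P ∩ G, |y - f a| :=
          mul_le_mul_of_nonneg_left (Finset.sum_le_sum fun a ha =>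
            hle a (Finset.mem_filter.1 (Finset.mem_inter.1 ha).1).2) (by norm_num)
      _ ≤ 6 * ∑ a ∈ G, |y - f a| := by
          gcongr
          exact Finset.inter_subset_right
  rcases le_total r y with h | h
  · refine key _ h1 fun a ha => ?_
    rw [abs_of_nonneg (sub_nonneg.2 h)]
    exact (by linarith : y - r ≤ y - f a).trans (le_abs_self _)
  · refine key _ h2 fun a ha => ?_
    rw [abs_of_nonpos (sub_nonpos.2 h)]
    exact (by linarith : -(y - r) ≤ -(y - f a)).trans (neg_le_abs _)

/-! ### Weighted double sums over pairs and paths. -/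

section Weights

variable {ι : Type*} [Fintype ι]

lemma sum_weight_mul_sum_le {x f : ι → ι → ℝ} {d : ℝ} (hf : ∀ i k, 0 ≤ f i k)
    (hd : ∀ i, ∑ j, x i j ≤ d) (V : Finset ι) :
    ∑ i, ∑ j, x i j * ∑ k ∈ V, f i k ≤ d * ∑ i, ∑ k ∈ V, f i k := by
  rw [Finset.mul_sum]
  refine Finset.sum_le_sum fun i _ => ?_
  rw [← Finset.sum_mul]
  exact mul_le_mul_of_nonneg_right (hd i) (Finset.sum_nonneg fun k _ => hf i k)

lemma sum_weight_mul_sum_le' {x f : ι → ι → ℝ} {d : ℝ} (hf : ∀ i k, 0 ≤ f i k)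
    (hx : ∀ i j, x i j = x j i) (hd : ∀ i, ∑ j, x i j ≤ d) (V : Finset ι) :
    ∑ i, ∑ j, x i j * ∑ k ∈ V, f j k ≤ d * ∑ i, ∑ k ∈ V, f i k := by
  rw [Finset.sum_comm]
  simp_rw [fun i j => hx i j]
  exact sum_weight_mul_sum_le hf hd V

/-- If the weight of every pair `ij` is controlled through the paths `ikj` in a graph with adjacency
weights `g`, then the weighted sum is controlled by the sum along the graph. -/
lemma weighted_sum_le_of_paths {x g η : ι → ι → ℝ} {d M : ℝ} (hη : ∀ i j, 0 ≤ η i j)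
    (hx : ∀ i j, x i j = x j i) (hg0 : ∀ i j, 0 ≤ g i j)
    (hd : ∀ i k, ∑ j, x i j * g j k ≤ d)
    (hw : ∀ i j, x i j * (M * η i j) ≤ x i j * ∑ k, g i k * g j k * (η i k + η j k)) :
    M * ∑ i, ∑ j, x i j * η i j ≤ 2 * d * ∑ i, ∑ k, g i k * η i k := by
  have half : ∑ i, ∑ j, ∑ k, x i j * (g i k * g j k * η i k) ≤ d * ∑ i, ∑ k, g i k * η i k := by
    rw [Finset.mul_sum]
    refine Finset.sum_le_sum fun i _ => ?_
    rw [Finset.sum_comm, Finset.mul_sum]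
    refine Finset.sum_le_sum fun k _ => ?_
    calc ∑ j, x i j * (g i k * g j k * η i k) = (∑ j, x i j * g j k) * (g i k * η i k) := by
          rw [Finset.sum_mul]; exact Finset.sum_congr rfl fun j _ => by ring
      _ ≤ d * (g i k * η i k) :=
          mul_le_mul_of_nonneg_right (hd i k) (mul_nonneg (hg0 i k) (hη i k))
  have half' : ∑ i, ∑ j, ∑ k, x i j * (g i k * g j k * η j k) ≤
      d * ∑ i, ∑ k, g i k * η i k := by
    rw [Finset.sum_comm]
    refine (le_of_eq ?_).trans half
    refine Finset.sum_congr rfl fun i _ => Finset.sum_congr rfl fun j _ =>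
      Finset.sum_congr rfl fun k _ => ?_
    rw [hx]; ring
  calc M * ∑ i, ∑ j, x i j * η i j = ∑ i, ∑ j, x i j * (M * η i j) := by
        rw [Finset.mul_sum]
        refine Finset.sum_congr rfl fun i _ => ?_
        rw [Finset.mul_sum]
        exact Finset.sum_congr rfl fun j _ => by ring
    _ ≤ ∑ i, ∑ j, x i j * ∑ k, g i k * g j k * (η i k + η j k) :=
        Finset.sum_le_sum fun i _ => Finset.sum_le_sum fun j _ => hw i j
    _ = ∑ i, ∑ j, ∑ k, x i j * (g i k * g j k * η i k) +
          ∑ i, ∑ j, ∑ k, x i j * (g i k * g j k * η j k) := by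
        simp_rw [← Finset.sum_add_distrib]
        refine Finset.sum_congr rfl fun i _ => Finset.sum_congr rfl fun j _ => ?_
        rw [Finset.mul_sum]
        exact Finset.sum_congr rfl fun k _ => by ring
    _ ≤ _ := by linarith

end Weights

/-- The relative stretchings `δ` and the non-parallel parts `η` of the motions of all pairs of
points with distances `D`, related by the triangles with large angles. -/
structure TriangleMotion (ι : Type*) where
  D : ι → ι → ℝ
  δ : ι → ι → ℝ
  η : ι → ι → ℝ
  β : ℝ
  good : ι → ι → ι → Prop
  β_pos : 0 < β
  D_nonneg : ∀ i j, 0 ≤ D i j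
  D_self : ∀ i, D i i = 0
  D_symm : ∀ i j, D i j = D j i
  D_triangle : ∀ i j k, D i j ≤ D i k + D j k
  δ_symm : ∀ i j, δ i j = δ j i
  η_nonneg : ∀ i j, 0 ≤ η i j
  η_symm : ∀ i j, η i j = η j i
  good_symm : ∀ {i j k}, good i j k → good j i k
  stretch : ∀ {i j k}, good i j k → β * (D i j * |δ i j - δ i k|) ≤ η i j + η i k + η j k

/-! ### Propagating deviations of the stretching through triangles. -/

namespace TriangleMotion

variable {ι : Type*} (T : TriangleMotion ι)

/-- The deviation of the stretching of the pair `ij` from the relative stretching `r`. -/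
def dev (r : ℝ) (i j : ι) : ℝ := T.D i j * |T.δ i j - r|

lemma dev_nonneg (r : ℝ) (i j : ι) : 0 ≤ T.dev r i j :=
  mul_nonneg (T.D_nonneg i j) (abs_nonneg _)

lemma dev_symm (r : ℝ) (i j : ι) : T.dev r i j = T.dev r j i := by
  rw [dev, dev, T.D_symm, T.δ_symm]

lemma dev_self (r : ℝ) (i : ι) : T.dev r i i = 0 := by
  rw [dev, T.D_self, zero_mul]

variable {T}

lemma stretch' {i j k : ι} (h : T.good i j k) :
    T.β * (T.D i j * |T.δ i j - T.δ j k|) ≤ T.η i j + T.η i k + T.η j k := by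
  have := T.stretch (T.good_symm h)
  rw [T.D_symm j i, T.δ_symm j i, T.η_symm j i] at this
  linarith

/-- The longer of the sides `ik` and `jk` is at least half of `ij`; comparing `δ i j` with the
stretching of that side loses only a factor 2. -/
lemma dev_le {i j k : ι} (h : T.good i j k) (r : ℝ) :
    T.β * T.dev r i j ≤
      (T.η i j + T.η i k + T.η j k) + 2 * T.β * (T.dev r i k + T.dev r j k) := by
  have hβ := T.β_pos
  have key : ∀ e D', T.D i j ≤ 2 * D' →
      T.β * (T.D i j * |T.δ i j - e|) ≤ T.η i j + T.η i k + T.η j k →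
      T.β * T.dev r i j ≤ T.η i j + T.η i k + T.η j k + 2 * T.β * (D' * |e - r|) := by
    intro e D' hD hs
    have h1 : |T.δ i j - r| ≤ |T.δ i j - e| + |e - r| := abs_sub_le _ _ _
    have h2 : T.D i j * |T.δ i j - r| ≤ T.D i j * |T.δ i j - e| + 2 * D' * |e - r| := by
      have := mul_le_mul_of_nonneg_left h1 (T.D_nonneg i j)
      have := mul_le_mul_of_nonneg_right hD (abs_nonneg (e - r))
      linarith
    have h3 := mul_le_mul_of_nonneg_left h2 hβ.le
    rw [dev]
    linarith
  have h1 := mul_nonneg hβ.le (T.dev_nonneg r i k)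
  have h2 := mul_nonneg hβ.le (T.dev_nonneg r j k)
  rcases le_total (T.D i k) (T.D j k) with hle | hle
  · have := key (T.δ j k) (T.D j k) (by linarith [T.D_triangle i j k]) (stretch' h)
    rw [← dev] at this
    linarith
  · have := key (T.δ i k) (T.D i k) (by linarith [T.D_triangle i j k]) (T.stretch h)
    rw [← dev] at this
    linarith

variable [Fintype ι]

variable (T) in
/-- The total non-parallel motion, over ordered pairs. -/
def total : ℝ := ∑ i, ∑ j, T.η i j

lemma total_nonneg : 0 ≤ T.total :=
  Finset.sum_nonneg fun i _ => Finset.sum_nonneg fun j _ => T.η_nonneg i j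

-- Sums `dev_le` over the well-placed third points `k` in `V`, at least `m` of them for each pair in
-- the support of `x`. The row bound `d` then limits how often each term of a row is counted.
open Classical in
lemma weighted_sum_dev_le {x : ι → ι → ℝ} {d m : ℝ} (hx0 : ∀ i j, 0 ≤ x i j)
    (hx : ∀ i j, x i j = x j i) (hd : ∀ i, ∑ j, x i j ≤ d) {V : Finset ι}
    (hm : ∀ i j, x i j ≠ 0 → m ≤ (V.filter (T.good i j)).card) (r : ℝ) :
    m * (T.β * ∑ i, ∑ j, x i j * T.dev r i j) ≤
      Fintype.card ι * ∑ i, ∑ j, x i j * T.η i j + 2 * d * T.total +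
        4 * d * (T.β * ∑ i, ∑ k ∈ V, T.dev r i k) := by
  have hβ := T.β_pos
  have hpt : ∀ i j, m * (T.β * (x i j * T.dev r i j)) ≤
      Fintype.card ι * (x i j * T.η i j) + x i j * ∑ k, T.η i k + x i j * ∑ k, T.η j k +
        (2 * T.β * (x i j * ∑ k ∈ V, T.dev r i k) +
          2 * T.β * (x i j * ∑ k ∈ V, T.dev r j k)) := by
    intro i j
    by_cases hxz : x i j = 0
    · rw [hxz]; simp
    have hdev := mul_nonneg hβ.le (T.dev_nonneg r i j)
    have hsum : m * (T.β * T.dev r i j) ≤ ∑ k, (T.η i j + T.η i k + T.η j k) +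
        ∑ k ∈ V, 2 * T.β * (T.dev r i k + T.dev r j k) := by
      calc m * (T.β * T.dev r i j) ≤ (V.filter (T.good i j)).card * (T.β * T.dev r i j) :=
            mul_le_mul_of_nonneg_right (hm i j hxz) hdev
        _ = ∑ k ∈ V.filter (T.good i j), T.β * T.dev r i j := by
            rw [Finset.sum_const, nsmul_eq_mul]
        _ ≤ ∑ k ∈ V.filter (T.good i j), ((T.η i j + T.η i k + T.η j k) +
              2 * T.β * (T.dev r i k + T.dev r j k)) :=
            Finset.sum_le_sum fun k hk => dev_le (Finset.mem_filter.1 hk).2 r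
        _ = _ := Finset.sum_add_distrib
        _ ≤ _ := by
            refine add_le_add (Finset.sum_le_sum_of_subset_of_nonneg (Finset.subset_univ _)
              fun k _ _ => ?_) (Finset.sum_le_sum_of_subset_of_nonneg (Finset.filter_subset _ _)
              fun k _ _ => ?_)
            · have := T.η_nonneg i j; have := T.η_nonneg i k; have := T.η_nonneg j k
              positivity
            · have := T.dev_nonneg r i k; have := T.dev_nonneg r j k
              positivity
    rw [← Finset.mul_sum, Finset.sum_add_distrib, Finset.sum_add_distrib, Finset.sum_add_distrib,
      Finset.sum_const, Finset.card_univ, nsmul_eq_mul] at hsum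
    have := mul_le_mul_of_nonneg_left hsum (hx0 i j)
    linarith
  have h1 := sum_weight_mul_sum_le T.η_nonneg hd Finset.univ
  have h2 := sum_weight_mul_sum_le' T.η_nonneg hx hd Finset.univ
  have h3 := sum_weight_mul_sum_le (T.dev_nonneg r) hd V
  have h4 := sum_weight_mul_sum_le' (T.dev_nonneg r) hx hd V
  have hS := Finset.sum_le_sum fun i (_ : i ∈ Finset.univ) =>
    Finset.sum_le_sum fun j (_ : j ∈ Finset.univ) => hpt i j
  simp_rw [Finset.sum_add_distrib, ← Finset.mul_sum] at hS
  have h5 := mul_le_mul_of_nonneg_left h3 (mul_nonneg zero_le_two hβ.le)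
  have h6 := mul_le_mul_of_nonneg_left h4 (mul_nonneg zero_le_two hβ.le)
  rw [total]
  linarith

end TriangleMotion

/-! ### The reference stretching and its removal. -/

namespace TriangleMotion

variable {ι : Type*} {T : TriangleMotion ι}

/-- The comparison passes through the side `ik`, shared by the triangles `ijk` and `kli`; the factor
`2 * c₀` bounds the ratio of `D i j` to the long distance `D k l`. -/
lemma stretch_two_le {μ c₀ : ℝ} {i j k l : ι} (hc₀ : 0 ≤ c₀) (hD : T.D i j ≤ c₀ * μ)
    (hlong : μ / 2 ≤ T.D k l) (h1 : T.good i j k) (h2 : T.good k l i) :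
    T.β * (T.D i j * |T.δ i j - T.δ k l|) ≤ (T.η i j + T.η i k + T.η j k) +
      2 * c₀ * (T.η k l + T.η k i + T.η l i) := by
  have hβ := T.β_pos
  have hs1 := T.stretch h1
  have hs2 := T.stretch h2
  rw [T.δ_symm k i, abs_sub_comm] at hs2
  have htri : |T.δ i j - T.δ k l| ≤ |T.δ i j - T.δ i k| + |T.δ i k - T.δ k l| := abs_sub_le _ _ _
  have hDD : T.D i j ≤ 2 * c₀ * T.D k l := by nlinarith
  have h3 := mul_le_mul_of_nonneg_left htri (T.D_nonneg i j)
  have h4 := mul_le_mul_of_nonneg_right hDD (abs_nonneg (T.δ i k - T.δ k l))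
  have h5 := mul_le_mul_of_nonneg_left (h3.trans (mul_add _ _ _).le) hβ.le
  have h6 := mul_le_mul_of_nonneg_left h4 hβ.le
  have h7 := mul_le_mul_of_nonneg_left hs2 (mul_nonneg zero_le_two hc₀)
  linarith

variable [Fintype ι]

variable (T) in
open Classical in
/-- The ordered pairs whose distance is at least half of `μ`. -/
def long (μ : ℝ) : Finset (ι × ι) := Finset.univ.filter fun e => μ / 2 ≤ T.D e.1 e.2

variable (T) in
open Classical in
/-- The points that are badly placed with respect to more than a quarter of the pairs of `L`. -/
def poor (L : Finset (ι × ι)) : Finset ι :=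
  Finset.univ.filter fun i => L.card < 4 * (L.filter fun e => ¬ T.good e.1 e.2 i).card

lemma sum_offDiag_const [DecidableEq ι] (a : ℝ) :
    ∑ i : ι, ∑ j : ι, (if i ≠ j then a else 0) =
      Fintype.card ι * (Fintype.card ι - 1 : ℝ) * a := by
  have : ∀ i : ι, ∑ j : ι, (if i ≠ j then a else 0) = (Fintype.card ι - 1 : ℝ) * a := by
    intro i
    rw [← Finset.sum_filter, Finset.sum_const, Finset.filter_ne, nsmul_eq_mul,
      Finset.card_erase_of_mem (Finset.mem_univ i), Finset.card_univ,
      Nat.cast_sub (Fintype.card_pos_iff.2 ⟨i⟩), Nat.cast_one]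
  simp_rw [this]
  rw [Finset.sum_const, Finset.card_univ, nsmul_eq_mul, mul_assoc]

/-- A reverse Markov inequality: pairs that are not long contribute at most half of the mean, so the
long ones, each at most `c₀ * μ`, carry the other half. -/
lemma card_long {μ c₀ : ℝ} (hμ : 0 < μ) (hD : ∀ i j, T.D i j ≤ c₀ * μ)
    (hsum : ∑ i, ∑ j, T.D i j = Fintype.card ι * (Fintype.card ι - 1) * μ) :
    (Fintype.card ι : ℝ) * (Fintype.card ι - 1) ≤ 2 * c₀ * (T.long μ).card := by
  classical
  have hpt : ∀ i j, T.D i j ≤ (if i ≠ j then μ / 2 else 0) +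
      (if μ / 2 ≤ T.D i j then c₀ * μ else 0) := by
    intro i j
    have h := hD i j
    split_ifs with h1 h2 h2
    · linarith
    · linarith
    · linarith
    · have : i = j := not_not.1 h1
      rw [this, T.D_self]; simp
  have hS := Finset.sum_le_sum fun i (_ : i ∈ Finset.univ) =>
    Finset.sum_le_sum fun j (_ : j ∈ Finset.univ) => hpt i j
  simp_rw [Finset.sum_add_distrib] at hS
  rw [hsum, sum_offDiag_const, ← Fintype.sum_prod_type'
    (f := fun i j => if μ / 2 ≤ T.D i j then c₀ * μ else 0), ← Finset.sum_filter,
    Finset.sum_const, nsmul_eq_mul] at hS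
  have hL : (Finset.univ.filter fun e : ι × ι => μ / 2 ≤ T.D e.1 e.2) = T.long μ := by
    unfold long; congr
  rw [hL] at hS
  refine le_of_mul_le_mul_right ?_ hμ
  linarith

-- Double counting of incidences between pairs of `L` and badly placed points.
open Classical in
lemma card_poor_mul_le {L : Finset (ι × ι)} {q : ℝ}
    (hq : ∀ e ∈ L, ((Finset.univ.filter fun k => ¬ T.good e.1 e.2 k).card : ℝ) ≤ q) :
    ((T.poor L).card : ℝ) * L.card ≤ 4 * (q * L.card) := by
  calc ((T.poor L).card : ℝ) * L.card = ∑ i ∈ T.poor L, (L.card : ℝ) := by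
        rw [Finset.sum_const, nsmul_eq_mul]
    _ ≤ ∑ i ∈ T.poor L, 4 * ((L.filter fun e => ¬ T.good e.1 e.2 i).card : ℝ) := by
        refine Finset.sum_le_sum fun i hi => ?_
        exact_mod_cast (Finset.mem_filter.1 hi).2.le
    _ ≤ ∑ i, 4 * ((L.filter fun e => ¬ T.good e.1 e.2 i).card : ℝ) :=
        Finset.sum_le_sum_of_subset_of_nonneg (Finset.subset_univ _) fun i _ _ => by positivity
    _ = 4 * ∑ e ∈ L, ((Finset.univ.filter fun k => ¬ T.good e.1 e.2 k).card : ℝ) := by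
        rw [← Finset.mul_sum]
        congr 1
        simp_rw [Finset.card_filter, Nat.cast_sum]
        exact Finset.sum_comm
    _ ≤ 4 * ∑ e ∈ L, q := by
        have := Finset.sum_le_sum hq
        linarith
    _ = 4 * (q * L.card) := by rw [Finset.sum_const, nsmul_eq_mul, mul_comm q]

lemma sum_four :
    ∑ i, ∑ j, ∑ e : ι × ι, (T.η i j + T.η i e.1 + T.η j e.1) =
      3 * (Fintype.card ι : ℝ) ^ 2 * T.total := by
  have h3 : ∑ i, ∑ j, T.η i j = T.total := rfl
  simp_rw [Fintype.sum_prod_type, Finset.sum_const, Finset.card_univ, nsmul_eq_mul,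
    ← Finset.mul_sum, Finset.sum_add_distrib, Finset.sum_const, Finset.card_univ, nsmul_eq_mul,
    ← Finset.mul_sum]
  rw [h3]
  ring

lemma sum_four' :
    ∑ i, ∑ _j : ι, ∑ e : ι × ι, (T.η e.1 e.2 + T.η e.1 i + T.η e.2 i) =
      3 * (Fintype.card ι : ℝ) ^ 2 * T.total := by
  have h1 : ∑ i : ι, ∑ k, T.η k i = T.total := Finset.sum_comm
  have h3 : ∑ i, ∑ j, T.η i j = T.total := rfl
  simp_rw [Fintype.sum_prod_type, Finset.sum_const, Finset.card_univ, nsmul_eq_mul,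
    ← Finset.mul_sum, Finset.sum_add_distrib, Finset.sum_const, Finset.card_univ, nsmul_eq_mul,
    ← Finset.mul_sum]
  rw [h1, h3]
  ring

open Classical in
/-- The pairs outside of the few poorly placed points all stretch by about the same amount, the
median of the stretchings of the long pairs. -/
lemma exists_reference {μ c₀ q : ℝ} (hcard : 2 ≤ Fintype.card ι) (hμ : 0 < μ) (hc₀ : 1 ≤ c₀)
    (hD : ∀ i j, T.D i j ≤ c₀ * μ)
    (hsum : ∑ i, ∑ j, T.D i j = Fintype.card ι * (Fintype.card ι - 1) * μ)
    (hq : ∀ i j, i ≠ j → ((Finset.univ.filter fun k => ¬ T.good i j k).card : ℝ) ≤ q)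
    (hqc : 72 * c₀ * q ≤ Fintype.card ι) :
    ∃ (r : ℝ) (U : Finset ι), (U.card : ℝ) ≤ 4 * q ∧
      T.β * ∑ i ∈ Uᶜ, ∑ j, T.dev r i j ≤ 216 * c₀ ^ 2 * T.total := by
  have hβ := T.β_pos
  set n : ℝ := (Fintype.card ι : ℝ) with hn
  have hn2 : 2 ≤ n := by rw [hn]; exact_mod_cast hcard
  set L := T.long μ with hL
  have hLcard := card_long hμ hD hsum
  rw [← hL, ← hn] at hLcard
  have hLn : n ^ 2 ≤ 4 * c₀ * L.card := by nlinarith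
  have hLpos : (0 : ℝ) < L.card := by
    by_contra! h
    nlinarith
  have hLne : ∀ e ∈ L, e.1 ≠ e.2 := by
    intro e he h
    have := (Finset.mem_filter.1 he).2
    rw [h, T.D_self] at this
    linarith
  obtain ⟨r, hr1, hr2⟩ := exists_median L (fun e => T.δ e.1 e.2)
  refine ⟨r, T.poor L, ?_, ?_⟩
  · have := card_poor_mul_le (T := T) (L := L) fun e he => hq e.1 e.2 (hLne e he)
    rw [← mul_assoc] at this
    exact le_of_mul_le_mul_right this hLpos
  have hpt : ∀ i ∈ (T.poor L)ᶜ, ∀ j, L.card * (T.β * T.dev r i j) ≤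
      6 * (∑ e : ι × ι, (T.η i j + T.η i e.1 + T.η j e.1) +
        2 * c₀ * ∑ e : ι × ι, (T.η e.1 e.2 + T.η e.1 i + T.η e.2 i)) := by
    intro i hi j
    have hnn : ∀ e : ι × ι, 0 ≤ (T.η i j + T.η i e.1 + T.η j e.1) +
        2 * c₀ * (T.η e.1 e.2 + T.η e.1 i + T.η e.2 i) := by
      intro e
      have := T.η_nonneg i j; have := T.η_nonneg i e.1; have := T.η_nonneg j e.1
      have := T.η_nonneg e.1 e.2; have := T.η_nonneg e.1 i; have := T.η_nonneg e.2 i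
      positivity
    rw [Finset.mul_sum, ← Finset.sum_add_distrib]
    by_cases hij : i = j
    · subst hij
      rw [T.dev_self]
      have := Finset.sum_nonneg fun e (_ : e ∈ Finset.univ) => hnn e
      linarith
    set G := L.filter fun e => T.good e.1 e.2 i ∧ T.good i j e.1 with hG
    have hnotpoor : 4 * (L.filter fun e => ¬ T.good e.1 e.2 i).card ≤ L.card := by
      by_contra! h
      exact Finset.mem_compl.1 hi (Finset.mem_filter.2 ⟨Finset.mem_univ _, h⟩)
    have hbad : ((L.filter fun e => ¬ T.good i j e.1).card : ℝ) ≤ q * n := by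
      have hsub : (L.filter fun e => ¬ T.good i j e.1) ⊆
          (Finset.univ.filter fun k => ¬ T.good i j k) ×ˢ Finset.univ := by
        intro e he
        simpa using (Finset.mem_filter.1 he).2
      have h1 := Finset.card_le_card hsub
      rw [Finset.card_product, Finset.card_univ] at h1
      calc ((L.filter fun e => ¬ T.good i j e.1).card : ℝ)
          ≤ ((Finset.univ.filter fun k => ¬ T.good i j k).card : ℝ) * n := by
            rw [hn]; exact_mod_cast h1
        _ ≤ q * n := by gcongr; exact hq i j hij
    have hcover : L.card ≤ G.card + ((L.filter fun e => ¬ T.good e.1 e.2 i).card +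
        (L.filter fun e => ¬ T.good i j e.1).card) := by
      refine (Finset.card_le_card fun e he => ?_).trans ((Finset.card_union_le _ _).trans
        (Nat.add_le_add_left (Finset.card_union_le _ _) _))
      simp only [hG, Finset.mem_union, Finset.mem_filter, he, true_and]
      tauto
    -- At most a quarter of `L` is lost because `i` is not poor, and at most `q * n`, which is at
    -- most an eighteenth of `L`, to bad triangles `ijk`; in total less than a third.
    have hGcard : 2 * L.card ≤ 3 * G.card := by
      have h1 : (L.card : ℝ) ≤ G.card + (((L.filter fun e => ¬ T.good e.1 e.2 i).card : ℝ) +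
        ((L.filter fun e => ¬ T.good i j e.1).card : ℝ)) := by exact_mod_cast hcover
      have h2 : 4 * ((L.filter fun e => ¬ T.good e.1 e.2 i).card : ℝ) ≤ L.card := by
        exact_mod_cast hnotpoor
      have h3 : c₀ * (18 * (q * n)) ≤ c₀ * L.card := by nlinarith
      have h4 := le_of_mul_le_mul_left h3 (by linarith)
      have h5 : 2 * (L.card : ℝ) ≤ 3 * G.card := by linarith
      exact_mod_cast h5
    have hmed := card_mul_abs_sub_median_le (Finset.filter_subset _ _) hGcard hr1 hr2 (T.δ i j)
    have hβD : 0 ≤ T.β * T.D i j := mul_nonneg hβ.le (T.D_nonneg i j)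
    calc L.card * (T.β * T.dev r i j) = (T.β * T.D i j) * (L.card * |T.δ i j - r|) := by
          rw [dev]; ring
      _ ≤ (T.β * T.D i j) * (6 * ∑ e ∈ G, |T.δ i j - T.δ e.1 e.2|) :=
          mul_le_mul_of_nonneg_left hmed hβD
      _ = 6 * ∑ e ∈ G, T.β * (T.D i j * |T.δ i j - T.δ e.1 e.2|) := by
          rw [← mul_assoc, mul_comm _ (6 : ℝ), mul_assoc, Finset.mul_sum]
          congr 1
          exact Finset.sum_congr rfl fun e _ => by ring
      _ ≤ 6 * ∑ e ∈ G, ((T.η i j + T.η i e.1 + T.η j e.1) +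
            2 * c₀ * (T.η e.1 e.2 + T.η e.1 i + T.η e.2 i)) := by
          refine mul_le_mul_of_nonneg_left (Finset.sum_le_sum fun e he => ?_) (by norm_num)
          obtain ⟨heL, hg1, hg2⟩ := Finset.mem_filter.1 he
          exact stretch_two_le (by linarith) (hD i j) (Finset.mem_filter.1 heL).2 hg2 hg1
      _ ≤ _ := mul_le_mul_of_nonneg_left (Finset.sum_le_sum_of_subset_of_nonneg
          (Finset.subset_univ _) fun e _ _ => hnn e) (by norm_num)
  have hS : L.card * (T.β * ∑ i ∈ (T.poor L)ᶜ, ∑ j, T.dev r i j) ≤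
      6 * (3 * n ^ 2 * T.total + 2 * c₀ * (3 * n ^ 2 * T.total)) := by
    calc L.card * (T.β * ∑ i ∈ (T.poor L)ᶜ, ∑ j, T.dev r i j)
        = ∑ i ∈ (T.poor L)ᶜ, ∑ j, L.card * (T.β * T.dev r i j) := by
          simp_rw [Finset.mul_sum]
      _ ≤ ∑ i ∈ (T.poor L)ᶜ, ∑ j, 6 * (∑ e : ι × ι, (T.η i j + T.η i e.1 + T.η j e.1) +
        2 * c₀ * ∑ e : ι × ι, (T.η e.1 e.2 + T.η e.1 i + T.η e.2 i)) :=
          Finset.sum_le_sum fun i hi => Finset.sum_le_sum fun j _ => hpt i hi j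
      _ ≤ ∑ i, ∑ j, 6 * (∑ e : ι × ι, (T.η i j + T.η i e.1 + T.η j e.1) +
        2 * c₀ * ∑ e : ι × ι, (T.η e.1 e.2 + T.η e.1 i + T.η e.2 i)) := by
          refine Finset.sum_le_sum_of_subset_of_nonneg (Finset.subset_univ _) fun i _ _ => ?_
          refine Finset.sum_nonneg fun j _ => ?_
          have h1 : 0 ≤ ∑ e : ι × ι, (T.η i j + T.η i e.1 + T.η j e.1) :=
            Finset.sum_nonneg fun e _ => add_nonneg (add_nonneg (T.η_nonneg _ _)
              (T.η_nonneg _ _)) (T.η_nonneg _ _)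
          have h2 : 0 ≤ ∑ e : ι × ι, (T.η e.1 e.2 + T.η e.1 i + T.η e.2 i) :=
            Finset.sum_nonneg fun e _ => add_nonneg (add_nonneg (T.η_nonneg _ _)
              (T.η_nonneg _ _)) (T.η_nonneg _ _)
          positivity
      _ = _ := by
          have hlin : ∀ f g : ι → ι → ℝ, ∑ i, ∑ j, 6 * (f i j + 2 * c₀ * g i j) =
              6 * (∑ i, ∑ j, f i j + 2 * c₀ * ∑ i, ∑ j, g i j) := fun f g => by
            simp_rw [← Finset.mul_sum, Finset.sum_add_distrib, ← Finset.mul_sum]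
          rw [hlin (fun i j => ∑ e : ι × ι, (T.η i j + T.η i e.1 + T.η j e.1))
            (fun i _ => ∑ e : ι × ι, (T.η e.1 e.2 + T.η e.1 i + T.η e.2 i)), sum_four, sum_four']
  have hA : 0 ≤ T.β * ∑ i ∈ (T.poor L)ᶜ, ∑ j, T.dev r i j :=
    mul_nonneg hβ.le (Finset.sum_nonneg fun i _ => Finset.sum_nonneg fun j _ => T.dev_nonneg r i j)
  have hH := T.total_nonneg
  set A := T.β * ∑ i ∈ (T.poor L)ᶜ, ∑ j, T.dev r i j
  have h1 : n ^ 2 * A ≤ 4 * c₀ * (6 * (3 * n ^ 2 * T.total + 2 * c₀ * (3 * n ^ 2 * T.total))) :=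
    calc n ^ 2 * A ≤ 4 * c₀ * L.card * A := mul_le_mul_of_nonneg_right hLn hA
      _ = 4 * c₀ * (L.card * A) := by ring
      _ ≤ _ := mul_le_mul_of_nonneg_left hS (by linarith)
  -- The factor is `4 * c₀ * 6 * (3 + 6 * c₀) = 72 * c₀ + 144 * c₀ ^ 2`, at most `216 * c₀ ^ 2`.
  have h2 : n ^ 2 * A ≤ n ^ 2 * (216 * c₀ ^ 2 * T.total) := by
    refine h1.trans ?_
    have : 0 ≤ n ^ 2 * T.total * (c₀ * (c₀ - 1)) :=
      mul_nonneg (mul_nonneg (sq_nonneg _) hH) (mul_nonneg (by linarith) (by linarith))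
    linarith
  exact le_of_mul_le_mul_left h2 (by positivity)

open Classical in
/-- A motion that is on average free of stretching has stretchings bounded by its non-parallel
parts. -/
lemma sum_dev_zero_le {μ c₀ q : ℝ} (hcard : 2 ≤ Fintype.card ι) (hμ : 0 < μ) (hc₀ : 1 ≤ c₀)
    (hD : ∀ i j, T.D i j ≤ c₀ * μ)
    (hsum : ∑ i, ∑ j, T.D i j = Fintype.card ι * (Fintype.card ι - 1) * μ)
    (hδ : ∑ i, ∑ j, T.D i j ^ 2 * T.δ i j = 0)
    (hq : ∀ i j, i ≠ j → ((Finset.univ.filter fun k => ¬ T.good i j k).card : ℝ) ≤ q)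
    (hqc : 72 * c₀ * q ≤ Fintype.card ι) (hqn : 10 * q ≤ Fintype.card ι) :
    T.β * ∑ i, ∑ j, T.dev 0 i j ≤ 3468 * c₀ ^ 3 * T.total := by
  have hβ := T.β_pos
  have hH := T.total_nonneg
  obtain ⟨r, U, hU, hA⟩ := exists_reference hcard hμ hc₀ hD hsum hq hqc
  set n : ℝ := (Fintype.card ι : ℝ) with hn
  have hn2 : 2 ≤ n := by rw [hn]; exact_mod_cast hcard
  have hA' : T.β * ∑ i, ∑ k ∈ Uᶜ, T.dev r i k ≤ 216 * c₀ ^ 2 * T.total := by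
    rw [Finset.sum_comm]
    simp_rw [fun i k => T.dev_symm r i k]
    exact hA
  -- At most `4 * q` points lie in `U` and at most `q` are badly placed for `ij`; since `10 * q ≤
  -- n`, half of all points remain.
  have hm : ∀ i j : ι, (if i ≠ j then (1 : ℝ) else 0) ≠ 0 →
      n / 2 ≤ ((Uᶜ).filter (T.good i j)).card := by
    intro i j h
    have hij : i ≠ j := by
      intro h'; simp [h'] at h
    have hcov : Fintype.card ι ≤ ((Uᶜ).filter (T.good i j)).card +
        (U.card + (Finset.univ.filter fun k => ¬ T.good i j k).card) := by
      rw [← Finset.card_univ]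
      refine (Finset.card_le_card fun e _ => ?_).trans ((Finset.card_union_le _ _).trans
        (Nat.add_le_add_left (Finset.card_union_le _ _) _))
      simp only [Finset.mem_union, Finset.mem_filter, Finset.mem_compl, Finset.mem_univ, true_and]
      tauto
    have h1 : n ≤ ((Uᶜ).filter (T.good i j)).card +
        ((U.card : ℝ) + (Finset.univ.filter fun k => ¬ T.good i j k).card) := by
      rw [hn]; exact_mod_cast hcov
    linarith [hq i j hij]
  have hw := weighted_sum_dev_le (T := T) (x := fun i j => if i ≠ j then 1 else 0) (d := n)
    (fun i j => by positivity) (fun i j => by simp only [ne_comm])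
    (fun i => by
      refine (Finset.sum_le_sum (g := fun _ => (1 : ℝ)) fun j _ => ?_).trans (by simp [hn])
      split_ifs <;> norm_num) hm r
  rw [← hn] at hw
  have hx1 : ∑ i, ∑ j, (if i ≠ j then (1 : ℝ) else 0) * T.dev r i j =
      ∑ i, ∑ j, T.dev r i j := by
    refine Finset.sum_congr rfl fun i _ => Finset.sum_congr rfl fun j _ => ?_
    split_ifs with h
    · rw [one_mul]
    · rw [not_not.1 h, T.dev_self, mul_zero]
  have hx2 : ∑ i, ∑ j, (if i ≠ j then (1 : ℝ) else 0) * T.η i j ≤ T.total := by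
    refine Finset.sum_le_sum fun i _ => Finset.sum_le_sum fun j _ => ?_
    split_ifs with h
    · rw [one_mul]
    · rw [zero_mul]; exact T.η_nonneg i j
  rw [hx1] at hw
  -- Here `1734 = 2 * (1 + 2 + 4 * 216)`.
  have hB : T.β * ∑ i, ∑ j, T.dev r i j ≤ 1734 * c₀ ^ 2 * T.total := by
    have h0 : 0 < n / 2 := by linarith
    refine le_of_mul_le_mul_left ?_ h0
    have h1 := mul_le_mul_of_nonneg_left hx2 (by linarith : 0 ≤ n)
    have h2 := mul_le_mul_of_nonneg_left hA' (by linarith : 0 ≤ 4 * n)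
    have h3 : 0 ≤ n * T.total * (c₀ ^ 2 - 1) :=
      mul_nonneg (mul_nonneg (by linarith) hH) (by nlinarith)
    linarith
  set F := ∑ i, ∑ j, T.dev r i j with hF
  have hF0 : 0 ≤ F := Finset.sum_nonneg fun i _ => Finset.sum_nonneg fun j _ => T.dev_nonneg r i j
  -- The mean square is at least the squared mean, obtained termwise from `2 * μ * D ≤ D ^ 2 + μ ^
  -- 2`.
  have hQ : n * (n - 1) * μ ^ 2 ≤ ∑ i, ∑ j, T.D i j ^ 2 := by
    have hpt : ∀ i j, 2 * μ * T.D i j ≤ T.D i j ^ 2 + (if i ≠ j then μ ^ 2 else 0) := by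
      intro i j
      split_ifs with h
      · nlinarith [sq_nonneg (T.D i j - μ)]
      · rw [not_not.1 h, T.D_self]; simp
    have hS := Finset.sum_le_sum fun i (_ : i ∈ Finset.univ) =>
      Finset.sum_le_sum fun j (_ : j ∈ Finset.univ) => hpt i j
    simp_rw [Finset.sum_add_distrib, ← Finset.mul_sum] at hS
    rw [hsum, sum_offDiag_const, ← hn] at hS
    linarith
  -- The `D ^ 2`-weighted mean of `δ` is zero, so `r` is the weighted mean of `r - δ`, which the
  -- deviations control.
  have hr : |r| * ∑ i, ∑ j, T.D i j ^ 2 ≤ c₀ * μ * F := by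
    have h1 : r * ∑ i, ∑ j, T.D i j ^ 2 = ∑ i, ∑ j, T.D i j ^ 2 * (r - T.δ i j) := by
      simp_rw [mul_sub, Finset.sum_sub_distrib]
      rw [hδ, sub_zero, Finset.mul_sum]
      refine Finset.sum_congr rfl fun i _ => ?_
      rw [Finset.mul_sum]
      exact Finset.sum_congr rfl fun j _ => mul_comm _ _
    have hQ0 : 0 ≤ ∑ i, ∑ j, T.D i j ^ 2 :=
      Finset.sum_nonneg fun i _ => Finset.sum_nonneg fun j _ => sq_nonneg _
    rw [← abs_of_nonneg hQ0, ← abs_mul, h1, hF, Finset.mul_sum]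
    refine (Finset.abs_sum_le_sum_abs _ _).trans (Finset.sum_le_sum fun i _ => ?_)
    rw [Finset.mul_sum]
    refine (Finset.abs_sum_le_sum_abs _ _).trans (Finset.sum_le_sum fun j _ => ?_)
    rw [abs_mul, abs_of_nonneg (sq_nonneg _), abs_sub_comm, dev, sq, mul_assoc]
    exact mul_le_mul_of_nonneg_right (hD i j) (mul_nonneg (T.D_nonneg i j) (abs_nonneg _))
  have hrn : |r| * (n * (n - 1) * μ) ≤ c₀ * F := by
    refine le_of_mul_le_mul_left ?_ hμ
    have := mul_le_mul_of_nonneg_left hQ (abs_nonneg r)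
    linarith
  have hdev0 : ∑ i, ∑ j, T.dev 0 i j ≤ F + |r| * (n * (n - 1) * μ) := by
    rw [← hsum, hF, Finset.mul_sum, ← Finset.sum_add_distrib]
    refine Finset.sum_le_sum fun i _ => ?_
    rw [Finset.mul_sum, ← Finset.sum_add_distrib]
    refine Finset.sum_le_sum fun j _ => ?_
    rw [dev, dev, sub_zero, mul_comm |r|, ← mul_add]
    refine mul_le_mul_of_nonneg_left ?_ (T.D_nonneg i j)
    simpa using abs_add_le (T.δ i j - r) r
  calc T.β * ∑ i, ∑ j, T.dev 0 i j ≤ T.β * (F + c₀ * F) :=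
        mul_le_mul_of_nonneg_left (by linarith) hβ.le
    _ = (1 + c₀) * (T.β * F) := by ring
    _ ≤ (2 * c₀) * (1734 * c₀ ^ 2 * T.total) := by
        refine mul_le_mul (by linarith) hB (mul_nonneg hβ.le hF0) (by linarith)
    _ = _ := by ring

open Classical in
/-- The stretching along a graph `x` of small maximal degree `d` is a small part of the non-parallel
motion. -/
lemma sum_dev_sparse_le {μ c₀ q d : ℝ} {x : ι → ι → ℝ} (hcard : 2 ≤ Fintype.card ι)
    (hμ : 0 < μ) (hc₀ : 1 ≤ c₀) (hD : ∀ i j, T.D i j ≤ c₀ * μ)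
    (hsum : ∑ i, ∑ j, T.D i j = Fintype.card ι * (Fintype.card ι - 1) * μ)
    (hδ : ∑ i, ∑ j, T.D i j ^ 2 * T.δ i j = 0)
    (hq : ∀ i j, i ≠ j → ((Finset.univ.filter fun k => ¬ T.good i j k).card : ℝ) ≤ q)
    (hqc : 72 * c₀ * q ≤ Fintype.card ι) (hqn : 10 * q ≤ Fintype.card ι)
    (hx0 : ∀ i j, 0 ≤ x i j) (hxd : ∀ i, x i i = 0) (hx : ∀ i j, x i j = x j i) (hd0 : 0 ≤ d)
    (hd : ∀ i, ∑ j, x i j ≤ d * Fintype.card ι) :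
    T.β * ∑ i, ∑ j, x i j * T.dev 0 i j ≤
      2 * ∑ i, ∑ j, x i j * T.η i j + 27748 * d * c₀ ^ 3 * T.total := by
  have hH := T.total_nonneg
  have hA := sum_dev_zero_le hcard hμ hc₀ hD hsum hδ hq hqc hqn
  set n : ℝ := (Fintype.card ι : ℝ) with hn
  have hn2 : 2 ≤ n := by rw [hn]; exact_mod_cast hcard
  have hw := weighted_sum_dev_le (T := T) (m := n / 2) (V := Finset.univ) hx0 hx hd (fun i j h => by
    have hij : i ≠ j := fun h' => h (by rw [h', hxd])
    have h1 := Finset.card_filter_add_card_filter_not (s := Finset.univ) (T.good i j)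
    rw [Finset.card_univ] at h1
    have h2 : ((Finset.univ.filter (T.good i j)).card : ℝ) +
      (Finset.univ.filter fun k => ¬ T.good i j k).card = n := by rw [hn]; exact_mod_cast h1
    linarith [hq i j hij]) 0
  rw [← hn] at hw
  refine le_of_mul_le_mul_left ?_ (by linarith : 0 < n / 2)
  have h1 := mul_le_mul_of_nonneg_left hA (by positivity : 0 ≤ 4 * (d * n))
  have hc3 : 1 ≤ c₀ ^ 3 := one_le_pow₀ hc₀
  have h2 : 0 ≤ d * n * T.total * (c₀ ^ 3 - 1) := by
    have : 0 ≤ c₀ ^ 3 - 1 := by linarith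
    positivity
  -- Dividing by `n / 2` leaves `2 * (2 + 4 * 3468 * c₀ ^ 3)`, at most `27748 * c₀ ^ 3`.
  linarith

end TriangleMotion

/-! ### Edge sums as sums over ordered pairs. -/

section Graphs

variable {n : ℕ}

open Classical in
/-- The adjacency indicator of a graph. -/
def adjWeight (G : SimpleGraph (Fin n)) (i j : Fin n) : ℝ := if G.Adj i j then 1 else 0

lemma adjWeight_nonneg (G : SimpleGraph (Fin n)) (i j : Fin n) : 0 ≤ adjWeight G i j := by
  unfold adjWeight; split_ifs <;> norm_num

lemma adjWeight_le_one (G : SimpleGraph (Fin n)) (i j : Fin n) : adjWeight G i j ≤ 1 := by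
  unfold adjWeight; split_ifs <;> norm_num

lemma adjWeight_symm (G : SimpleGraph (Fin n)) (i j : Fin n) :
    adjWeight G i j = adjWeight G j i := by
  unfold adjWeight; congr 1; exact propext (G.adj_comm i j)

lemma adjWeight_self (G : SimpleGraph (Fin n)) (i : Fin n) : adjWeight G i i = 0 := by
  simp [adjWeight]

lemma sum_adjWeight (G : SimpleGraph (Fin n)) (i : Fin n) :
    ∑ j, adjWeight G i j = ((G.neighborSet i).ncard : ℝ) := by
  classical
  unfold adjWeight
  rw [Finset.sum_boole, Set.ncard_eq_toFinset_card']
  congr 2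
  ext j; simp

lemma adjWeight_mul (G : SimpleGraph (Fin n)) (i j k : Fin n) (a : ℝ)
    [Decidable (G.Adj i k ∧ G.Adj j k)] :
    adjWeight G i k * adjWeight G j k * a = if G.Adj i k ∧ G.Adj j k then a else 0 := by
  unfold adjWeight
  by_cases h1 : G.Adj i k <;> by_cases h2 : G.Adj j k <;> simp [h1, h2]

lemma sum_adjWeight_graphOf {A : Finset (Fin n × Fin n)} (hA : ∀ i j, (i, j) ∈ A → (j, i) ∉ A)
    {f : Fin n → Fin n → ℝ} (hf : ∀ i j, f i j = f j i) :
    ∑ i, ∑ j, adjWeight (graphOf A) i j * f i j = 2 * ∑ e ∈ A, f e.1 e.2 := by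
  classical
  have hpt : ∀ i j, adjWeight (graphOf A) i j * f i j =
      (if (i, j) ∈ A then f i j else 0) + (if (j, i) ∈ A then f j i else 0) := by
    intro i j
    have hadj : (graphOf A).Adj i j ↔ (i, j) ∈ A ∨ (j, i) ∈ A := by
      rw [graphOf, SimpleGraph.fromRel_adj]
      refine ⟨fun h => h.2, fun h => ⟨?_, h⟩⟩
      rintro rfl
      exact hA i i (by tauto) (by tauto)
    unfold adjWeight
    rw [hadj]
    by_cases h1 : (i, j) ∈ A
    · simp [h1, hA _ _ h1]
    · simp [h1, hf i j]
  have hsum : ∑ i, ∑ j, (if (i, j) ∈ A then f i j else 0) = ∑ e ∈ A, f e.1 e.2 := by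
    rw [← Fintype.sum_prod_type' (f := fun i j => if (i, j) ∈ A then f i j else 0)]
    rw [Finset.sum_ite_mem, Finset.univ_inter]
  simp_rw [hpt, Finset.sum_add_distrib]
  rw [Finset.sum_comm (f := fun i j => if (j, i) ∈ A then f j i else 0), hsum, two_mul]

lemma sum_eq_meanDist (t : Fin n → E3) (hn : 2 ≤ n) :
    ∑ i, ∑ j, ‖t i - t j‖ = (n : ℝ) * (n - 1) * meanDist t := by
  classical
  set A := Finset.univ.filter (fun e : Fin n × Fin n => e.1 < e.2) with hA
  have h := sum_adjWeight_graphOf (A := A) (fun i j h h' => by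
    simp only [hA, Finset.mem_filter, Finset.mem_univ, true_and] at h h'
    exact lt_asymm h h') (f := fun i j => ‖t i - t j‖) (fun i j => norm_sub_rev _ _)
  have h2 : ∑ i, ∑ j, adjWeight (graphOf A) i j * ‖t i - t j‖ = ∑ i, ∑ j, ‖t i - t j‖ := by
    refine Finset.sum_congr rfl fun i _ => Finset.sum_congr rfl fun j _ => ?_
    by_cases hij : i = j
    · rw [hij, sub_self, norm_zero, mul_zero]
    · have : (graphOf A).Adj i j := by
        rw [graphOf, SimpleGraph.fromRel_adj]
        refine ⟨hij, ?_⟩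
        rcases lt_or_gt_of_ne hij with h | h
        · left; simp [hA, h]
        · right; simp [hA, h]
      rw [adjWeight, if_pos this, one_mul]
  rw [← h2, h, meanDist, Nat.cast_choose_two, ← hA]
  have h1 : (2 : ℝ) ≤ n := by exact_mod_cast hn
  have h3 : (n : ℝ) - 1 ≠ 0 := by linarith
  have h4 : (n : ℝ) ≠ 0 := by linarith
  field_simp

end Graphs

/-! ### Perpendicular parts and stretchings of a motion. -/

lemma norm_starProjection_orthogonal_le_projPerp {U : Submodule ℝ E3} {x y : E3}
    (hxy : y - x ∈ U) (v : E3) : ‖Uᗮ.starProjection v‖ ≤ ‖projPerp (x - y) v‖ := by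
  refine norm_starProjection_orthogonal_le_of_le ?_ _
  rw [Submodule.span_singleton_le_iff_mem]
  have := U.neg_mem hxy
  rwa [neg_sub] at this

/-- The non-parallel part of the motion `h` of the pair `ij`. -/
def perpPart {n : ℕ} (t h : Fin n → E3) (i j : Fin n) : ℝ := ‖projPerp (t i - t j) (h i - h j)‖

/-- The relative stretching of the pair `ij` under the motion `h`. -/
def stretching {n : ℕ} (t h : Fin n → E3) (i j : Fin n) : ℝ :=
  inner ℝ (t i - t j) (h i - h j) / ‖t i - t j‖ ^ 2

section Motion

variable {n : ℕ} (t h : Fin n → E3)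

lemma perpPart_symm (i j : Fin n) : perpPart t h i j = perpPart t h j i := by
  rw [perpPart, perpPart, ← neg_sub (t j), ← neg_sub (h j), projPerp_neg_left, projPerp_neg,
    norm_neg]

lemma perpPart_nonneg (i j : Fin n) : 0 ≤ perpPart t h i j := norm_nonneg _

lemma perpPart_self (i : Fin n) : perpPart t h i i = 0 := by
  rw [perpPart, sub_self (h i), projPerp_zero, norm_zero]

lemma perpPart_eq (i j : Fin n) :
    perpPart t h i j = ‖(h i - h j) - stretching t h i j • (t i - t j)‖ := by
  rw [perpPart, projPerp_eq, stretching]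

lemma stretching_symm (i j : Fin n) : stretching t h i j = stretching t h j i := by
  rw [stretching, stretching, ← neg_sub (t j), ← neg_sub (h j), inner_neg_neg, norm_neg]

lemma norm_sub_le_perpPart_add (i j : Fin n) :
    ‖h i - h j‖ ≤ perpPart t h i j + ‖t i - t j‖ * |stretching t h i j| := by
  rw [perpPart_eq, mul_comm, ← Real.norm_eq_abs, ← norm_smul]
  simpa using norm_add_le ((h i - h j) - stretching t h i j • (t i - t j))
    (stretching t h i j • (t i - t j))

lemma sum_sq_mul_stretching (hh : ∑ i, h i = 0) (hl : ∑ i, inner ℝ (h i) (t i) = (0 : ℝ)) :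
    ∑ i, ∑ j, ‖t i - t j‖ ^ 2 * stretching t h i j = 0 := by
  -- The weighted stretching is the inner product of `t i - t j` and `h i - h j`: its mixed terms
  -- vanish by centring, the others by orthogonality.
  have hpt : ∀ i j, ‖t i - t j‖ ^ 2 * stretching t h i j =
      (inner ℝ (h i) (t i) - inner ℝ (t i) (h j)) -
        (inner ℝ (t j) (h i) - inner ℝ (h j) (t j)) := by
    intro i j
    rw [real_inner_comm (t i) (h i), real_inner_comm (t j) (h j), ← inner_sub_right,
      ← inner_sub_right, ← inner_sub_left, stretching]
    by_cases h0 : t i - t j = 0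
    · rw [h0]; simp
    · rw [mul_div_cancel₀]
      exact pow_ne_zero 2 (norm_ne_zero_iff.2 h0)
  have h1 : ∑ i, ∑ j, (inner ℝ (t i) (h j) : ℝ) = 0 := Finset.sum_eq_zero fun i _ => by
    rw [← inner_sum, hh, inner_zero_right]
  have h2 : ∑ i : Fin n, ∑ j, (inner ℝ (h j) (t j) : ℝ) = 0 := Finset.sum_eq_zero fun _ _ => hl
  simp_rw [hpt, Finset.sum_sub_distrib]
  rw [Finset.sum_comm (f := fun i _ => inner ℝ (h i) (t i)),
    Finset.sum_comm (f := fun i j => inner ℝ (t j) (h i)), h1, h2]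
  simp

/-- In a well-distributed family, the non-parallel motion of a pair is controlled by that of the
paths of length two between its ends. -/
lemma perpPart_le_of_wellDistributed {c₁ M : ℝ} {G : SimpleGraph (Fin n)}
    (ht : Function.Injective t) (hG : IsWellDistributedAlong c₁ t G) (hc₁ : 0 ≤ c₁)
    {i j : Fin n} (hij : i ≠ j) (hM : M ≤ ((G.commonNeighbors i j).ncard : ℝ)) :
    M * c₁ * perpPart t h i j ≤
      ∑ k, adjWeight G i k * adjWeight G j k * (perpPart t h i k + perpPart t h j k) := by
  classical
  set A := Finset.univ.filter (fun k => G.Adj i k ∧ G.Adj j k) with hA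
  have hcard : (G.commonNeighbors i j).ncard = A.card := by
    rw [Set.ncard_eq_toFinset_card']
    congr 1
    ext k; simp [hA, SimpleGraph.mem_commonNeighbors]
  have hwd := hG i j hij (h i - h j)
  have hwd' : c₁ * perpPart t h i j ≤ (1 / (A.card : ℝ)) *
      ∑ k ∈ A, ‖((Submodule.span ℝ {t k - t i, t k - t j})ᗮ).starProjection (h i - h j)‖ := by
    rw [← Finset.sum_image (f := fun a =>
      ‖((Submodule.span ℝ {a - t i, a - t j})ᗮ).starProjection (h i - h j)‖)
      (fun _ _ _ _ e => ht e), ← Finset.card_image_of_injective A ht]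
    exact hwd
  -- Passing through `h k` splits the motion in two; the span contains the directions of both sides,
  -- so its complement sees at most their perpendicular parts.
  have hproj : ∀ k, ‖((Submodule.span ℝ {t k - t i, t k - t j})ᗮ).starProjection (h i - h j)‖ ≤
      perpPart t h i k + perpPart t h j k := by
    intro k
    set U : Submodule ℝ E3 := Submodule.span ℝ {t k - t i, t k - t j} with hU
    have hi : t k - t i ∈ U := Submodule.subset_span (Set.mem_insert _ _)
    have hj : t k - t j ∈ U := Submodule.subset_span (Set.mem_insert_of_mem _ rfl)
    calc ‖Uᗮ.starProjection (h i - h j)‖ = ‖Uᗮ.starProjection ((h i - h k) - (h j - h k))‖ := by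
          rw [sub_sub_sub_cancel_right]
      _ = ‖Uᗮ.starProjection (h i - h k) - Uᗮ.starProjection (h j - h k)‖ := by
          rw [ContinuousLinearMap.map_sub]
      _ ≤ _ := norm_sub_le _ _
      _ ≤ _ := add_le_add (norm_starProjection_orthogonal_le_projPerp hi _)
          (norm_starProjection_orthogonal_le_projPerp hj _)
  have hsum : ∑ k, adjWeight G i k * adjWeight G j k * (perpPart t h i k + perpPart t h j k) =
      ∑ k ∈ A, (perpPart t h i k + perpPart t h j k) := by
    simp_rw [adjWeight_mul]
    rw [Finset.sum_filter]
  rw [hsum]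
  have hp : 0 ≤ c₁ * perpPart t h i j := mul_nonneg hc₁ (perpPart_nonneg _ _ _ _)
  have hle : (A.card : ℝ) * (c₁ * perpPart t h i j) ≤
      ∑ k ∈ A, (perpPart t h i k + perpPart t h j k) := by
    rcases Nat.eq_zero_or_pos A.card with h0 | h0
    · rw [h0, Nat.cast_zero, zero_mul]
      exact Finset.sum_nonneg fun k _ =>
        add_nonneg (perpPart_nonneg _ _ _ _) (perpPart_nonneg _ _ _ _)
    · have hpos : (0 : ℝ) < A.card := by exact_mod_cast h0
      have h2 := mul_le_mul_of_nonneg_left hwd' hpos.le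
      rw [← mul_assoc, ← mul_assoc, mul_one_div_cancel hpos.ne', one_mul] at h2
      rw [← mul_assoc]
      exact h2.trans (Finset.sum_le_sum fun k _ => hproj k)
  rw [hcard] at hM
  rw [mul_assoc]
  exact (mul_le_mul_of_nonneg_right hM hp).trans hle

end Motion

/-! ### Triangles of camera locations. -/

namespace CameraNetwork

variable {n : ℕ} (N : CameraNetwork n)

/-- The triangle `ijk` has angles at `i` and `j` whose sines are at least `β`. -/
def LargeAngles (β : ℝ) (i j k : Fin n) : Prop :=
  k ≠ i ∧ k ≠ j ∧ β ^ 2 ≤ 1 - inner ℝ (N.γstar i j) (N.γstar i k) ^ 2 ∧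
    β ^ 2 ≤ 1 - inner ℝ (N.γstar i j) (N.γstar j k) ^ 2

lemma γstar_swap (i j : Fin n) : N.γstar j i = -N.γstar i j := direction_swap _ _

variable {N}

lemma LargeAngles.symm {β : ℝ} {i j k : Fin n} (h : N.LargeAngles β i j k) :
    N.LargeAngles β j i k := by
  obtain ⟨h1, h2, h3, h4⟩ := h
  refine ⟨h2, h1, ?_, ?_⟩
  · rwa [N.γstar_swap i j, inner_neg_left, neg_sq]
  · rwa [N.γstar_swap i j, inner_neg_left, neg_sq]

/-- The right side is the height of the triangle over `jk`, that is `‖N.loc i - N.loc j‖` times the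
sine of the angle at `j`. -/
lemma LargeAngles.mul_norm_le {β : ℝ} (hβ : 0 < β) {i j k : Fin n} (h : N.LargeAngles β i j k) :
    β * ‖N.loc i - N.loc j‖ ≤ ‖projPerp (N.loc j - N.loc k) (N.loc i - N.loc j)‖ := by
  obtain ⟨-, hkj, -, h4⟩ := h
  by_cases hij : i = j
  · rw [hij]; simp
  have hjk := N.loc_ne (Ne.symm hkj)
  rw [← projPerp_direction hjk, ← sq_le_sq₀ (by positivity) (norm_nonneg _),
    norm_sq_projPerp (norm_direction hjk)]
  have h1 : inner ℝ (direction (N.loc j) (N.loc k)) (N.loc i - N.loc j) =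
      ‖N.loc i - N.loc j‖ * inner ℝ (N.γstar i j) (N.γstar j k) := by
    rw [γstar, γstar, real_inner_comm (direction (N.loc j) (N.loc k)), ← inner_smul_right,
      norm_smul_direction (N.loc_ne hij)]
  rw [h1]
  have := mul_le_mul_of_nonneg_left h4 (sq_nonneg ‖N.loc i - N.loc j‖)
  linarith

variable (N)

/-- The stretchings and non-parallel parts of a motion of the camera locations. -/
def triangleMotion (h : Fin n → E3) {β : ℝ} (hβ : 0 < β) : TriangleMotion (Fin n) where
  D i j := ‖N.loc i - N.loc j‖
  δ := stretching N.loc h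
  η := perpPart N.loc h
  β := β
  good := N.LargeAngles β
  β_pos := hβ
  D_nonneg _ _ := norm_nonneg _
  D_self i := by simp
  D_symm _ _ := norm_sub_rev _ _
  D_triangle i j k := by
    rw [norm_sub_rev (N.loc j)]
    exact norm_sub_le_norm_sub_add_norm_sub _ _ _
  δ_symm := stretching_symm _ _
  η_nonneg := perpPart_nonneg _ _
  η_symm := perpPart_symm _ _
  good_symm := LargeAngles.symm
  stretch {i j k} hg := by
    have hjk : N.loc i - N.loc k - (N.loc i - N.loc j) = N.loc j - N.loc k := by abel
    have hjk' : h i - h k - (h i - h j) = h j - h k := by abel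
    have h1 := triangle_stretch_le (perpPart_eq N.loc h i j).ge (perpPart_eq N.loc h i k).ge
      (a := N.loc i - N.loc j) (b := N.loc i - N.loc k) (δ₃ := stretching N.loc h j k)
      (η₃ := perpPart N.loc h j k) (by rw [hjk, hjk']; exact (perpPart_eq N.loc h j k).ge)
    rw [hjk] at h1
    have h2 := mul_le_mul_of_nonneg_left (hg.mul_norm_le hβ)
      (abs_nonneg (stretching N.loc h i j - stretching N.loc h i k))
    linarith

end CameraNetwork

/-! ### Good shape implies strict dominance. -/

namespace CameraNetwork

variable {n : ℕ} (N : CameraNetwork n)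

lemma sum_graph_E {f : Fin n → Fin n → ℝ} (hf : ∀ i j, f i j = f j i) :
    ∑ i, ∑ j, adjWeight (graphOf N.E) i j * f i j = 2 * ∑ e ∈ N.E, f e.1 e.2 :=
  sum_adjWeight_graphOf N.no_repetition hf

lemma sum_graph_EglCompl (c : ℝ) {f : Fin n → Fin n → ℝ} (hf : ∀ i j, f i j = f j i) :
    ∑ i, ∑ j, adjWeight (graphOf (N.EglCompl c)) i j * f i j =
      2 * ∑ e ∈ N.EglCompl c, f e.1 e.2 :=
  sum_adjWeight_graphOf (fun i j h h' => N.no_repetition i j (Finset.sdiff_subset h)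
    (Finset.sdiff_subset h')) hf

variable {N} {c p β ε₀ ε₁ c₀ c₁ : ℝ}

-- The shape condition bounds each cosine on one side only. Applying it to `ij` and to `ji` bounds
-- it on both sides, hence bounds the sine below; this doubles the exceptional set.
open Classical in
lemma card_not_largeAngles_le (hβ : β ∈ Set.Ioc (0 : ℝ) 1)
    (hshape : GoodShape N c p β ε₀ ε₁ c₀ c₁) {i j : Fin n} (hij : i ≠ j) :
    ((Finset.univ.filter fun k => ¬ N.LargeAngles β i j k).card : ℝ) ≤ 2 * ε₁ * n := by
  set P : Fin n → Fin n → Fin n → Prop := fun i j k => k ≠ i ∧ k ≠ j ∧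
    β ^ 2 ≤ 1 - inner ℝ (N.γstar i j) (N.γstar i k) ∧
      β ^ 2 ≤ 1 - inner ℝ (N.γstar i j) (N.γstar j k) with hP
  have hcount : ∀ i j, i ≠ j → ((Finset.univ.filter fun k => ¬ P i j k).card : ℝ) ≤ ε₁ * n := by
    intro i j hij
    have h1 := hshape.large_angles i j hij
    have h2 : ({k | P i j k} : Set (Fin n)).ncard = (Finset.univ.filter (P i j)).card := by
      rw [← Set.ncard_coe_finset]
      congr 1; ext k; simp
    have h3 := Finset.card_filter_add_card_filter_not (s := Finset.univ) (P i j)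
    rw [Finset.card_univ, Fintype.card_fin, ← h2] at h3
    have h4 : ((({k | P i j k} : Set (Fin n)).ncard : ℝ)) +
        ((Finset.univ.filter fun k => ¬ P i j k).card : ℝ) = n := by exact_mod_cast h3
    have h1' : (n : ℝ) - ε₁ * n ≤ (({k | P i j k} : Set (Fin n)).ncard : ℝ) := h1
    linarith
  have hsub : (Finset.univ.filter fun k => ¬ N.LargeAngles β i j k) ⊆
      (Finset.univ.filter fun k => ¬ P i j k) ∪ (Finset.univ.filter fun k => ¬ P j i k) := by
    intro k hk
    simp only [Finset.mem_union, Finset.mem_filter, Finset.mem_univ, true_and] at hk ⊢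
    by_contra! hcon
    obtain ⟨⟨h1, h2, h3, h4⟩, -, -, h5, h6⟩ := hcon
    rw [N.γstar_swap i j, inner_neg_left] at h5 h6
    have hsq : ∀ u : ℝ, β ^ 2 ≤ 1 - u → β ^ 2 ≤ 1 + u → β ^ 2 ≤ 1 - u ^ 2 := by
      intro u hu1 hu2
      have hb : 0 < β ^ 2 := pow_pos hβ.1 2
      rcases le_total 0 u with h | h <;> nlinarith
    exact hk ⟨h1, h2, hsq _ h3 (by linarith), hsq _ h4 (by linarith)⟩
  have hle : ((Finset.univ.filter fun k => ¬ N.LargeAngles β i j k).card : ℝ) ≤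
      (Finset.univ.filter fun k => ¬ P i j k).card +
        (Finset.univ.filter fun k => ¬ P j i k).card := by
    exact_mod_cast (Finset.card_le_card hsub).trans (Finset.card_union_le _ _)
  linarith [hcount i j hij, hcount j i hij.symm]

/-- The points `i` and `j` are themselves excluded in the angle condition, so `ε₁ * n ≥ 2`. -/
lemma card_ge_of_goodShape (hp : 0 < p) (hε₁ : ε₁ ≤ 1 / 96)
    (hshape : GoodShape N c p β ε₀ ε₁ c₀ c₁) :
    192 ≤ n ∧ ∃ i j : Fin n, i ≠ j := by
  obtain ⟨i⟩ := hshape.typical.connected.nonempty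
  have hn : 0 < (n : ℝ) := by exact_mod_cast i.pos
  have hdeg := (hshape.typical.degree i).1
  have hpos : 0 < ((graphOf N.E).neighborSet i).ncard := by
    have : (0 : ℝ) < ((graphOf N.E).neighborSet i).ncard :=
      lt_of_lt_of_le (by positivity) hdeg
    exact_mod_cast this
  obtain ⟨j, hj⟩ := Set.nonempty_of_ncard_ne_zero hpos.ne'
  have hij : i ≠ j := ((SimpleGraph.mem_neighborSet _ _ _).1 hj).ne
  refine ⟨?_, i, j, hij⟩
  have h1 := hshape.large_angles i j hij
  have h2 : ({k | k ≠ i ∧ k ≠ j ∧ β ^ 2 ≤ 1 - inner ℝ (N.γstar i j) (N.γstar i k) ∧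
        β ^ 2 ≤ 1 - inner ℝ (N.γstar i j) (N.γstar j k)} : Set (Fin n)).ncard + 2 ≤ n := by
    rw [← Set.ncard_pair hij, ← Set.ncard_union_eq]
    · refine (Set.ncard_le_ncard (Set.subset_univ _)).trans ?_
      simp [Set.ncard_univ]
    · rw [Set.disjoint_right]
      rintro k (rfl | rfl) hk
      · exact hk.1 rfl
      · exact hk.2.1 rfl
  have h3 : (({k | k ≠ i ∧ k ≠ j ∧ β ^ 2 ≤ 1 - inner ℝ (N.γstar i j) (N.γstar i k) ∧
        β ^ 2 ≤ 1 - inner ℝ (N.γstar i j) (N.γstar j k)} : Set (Fin n)).ncard : ℝ) + 2 ≤ n := by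
    exact_mod_cast h2
  have h4 : (192 : ℝ) ≤ n := by nlinarith
  exact_mod_cast h4

lemma ncard_commonNeighbors_top {i j : Fin n} (hij : i ≠ j) (hn : 4 ≤ n) :
    (1 / 2) * (n : ℝ) ≤ (((⊤ : SimpleGraph (Fin n)).commonNeighbors i j).ncard : ℝ) := by
  classical
  have h1 : (⊤ : SimpleGraph (Fin n)).commonNeighbors i j = ({i, j} : Set (Fin n))ᶜ := by
    ext k
    simp [SimpleGraph.mem_commonNeighbors, eq_comm]
  have h2 := Set.ncard_add_ncard_compl ({i, j} : Set (Fin n))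
  rw [← h1, Set.ncard_pair hij, Nat.card_fin] at h2
  have h3 : (2 : ℝ) + (((⊤ : SimpleGraph (Fin n)).commonNeighbors i j).ncard : ℝ) = n := by
    exact_mod_cast h2
  have h4 : (4 : ℝ) ≤ n := by exact_mod_cast hn
  linarith

lemma sum_edges_le_of_wellDistributed {G : SimpleGraph (Fin n)} {x : Fin n → Fin n → ℝ} {M d : ℝ}
    (h : Fin n → E3) (hG : IsWellDistributedAlong c₁ N.loc G) (hc₁ : 0 ≤ c₁)
    (hM : ∀ i j, i ≠ j → M ≤ ((G.commonNeighbors i j).ncard : ℝ))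
    (hx0 : ∀ i j, 0 ≤ x i j) (hx : ∀ i j, x i j = x j i)
    (hd : ∀ i k, ∑ j, x i j * adjWeight G j k ≤ d) :
    M * c₁ * ∑ i, ∑ j, x i j * perpPart N.loc h i j ≤
      2 * d * ∑ i, ∑ j, adjWeight G i j * perpPart N.loc h i j := by
  refine weighted_sum_le_of_paths (perpPart_nonneg _ _) hx (adjWeight_nonneg G) hd fun i j => ?_
  refine mul_le_mul_of_nonneg_left ?_ (hx0 i j)
  by_cases hij : i = j
  · rw [hij, perpPart_self, mul_zero]
    exact Finset.sum_nonneg fun k _ => mul_nonneg (mul_nonneg (adjWeight_nonneg _ _ _)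
      (adjWeight_nonneg _ _ _)) (add_nonneg (perpPart_nonneg _ _ _ _) (perpPart_nonneg _ _ _ _))
  · exact perpPart_le_of_wellDistributed _ _ N.loc_injective hG hc₁ hij (hM i j hij)

/-- A family of good shape satisfies the strict dominance condition. -/
theorem strictDominance_of_goodShape
    (hp : p ∈ Set.Ioc (0 : ℝ) 1) (hβ : β ∈ Set.Ioc (0 : ℝ) 1)
    (hε₀ : ε₀ ∈ Set.Ioc (0 : ℝ) 1) (hc₁ : c₁ ∈ Set.Ioc (0 : ℝ) 1) (hc₀ : 1 ≤ c₀)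
    (hshape : GoodShape N c p β ε₀ ε₁ c₀ c₁)
    (h₁ : ε₀ ≤ β * c₁ * p / (2 ^ 22 * c₀ ^ 3)) (h₂ : ε₀ ≤ β * c₁ ^ 2 * p / (2 ^ 20 * c₀))
    (h₃ : ε₀ ≤ c₁ * p ^ 2 / 16) (h₄ : ε₁ ≤ 1 / (144 * c₀)) (h₅ : ε₁ ≤ 1 / 96) :
    N.StrictDominance c := by
  classical
  intro h hh hl hne
  obtain ⟨hn192, i₀, j₀, hij₀⟩ := card_ge_of_goodShape hp.1 h₅ hshape
  have hn : (192 : ℝ) ≤ n := by exact_mod_cast hn192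
  have hn0 : (0 : ℝ) < n := by linarith
  have hc0 : 0 < c₀ := by linarith
  set T := N.triangleMotion h hβ.1 with hT
  set x := adjWeight (graphOf (N.EglCompl c)) with hx
  set g := adjWeight (graphOf N.E) with hg
  set η := perpPart N.loc h with hη
  have hx0 : ∀ i j, 0 ≤ x i j := adjWeight_nonneg _
  have hxs : ∀ i j, x i j = x j i := adjWeight_symm _
  have hxrow : ∀ i, ∑ j, x i j ≤ ε₀ * n := fun i => by
    rw [hx, sum_adjWeight]; exact hshape.max_degree i
  have hxg : ∀ (G : SimpleGraph (Fin n)) (i k : Fin n),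
      ∑ j, x i j * adjWeight G j k ≤ ε₀ * n := fun G i k =>
    (Finset.sum_le_sum fun j _ => mul_le_of_le_one_right (hx0 i j) (adjWeight_le_one G j k)).trans
      (hxrow i)
  have hH0 := T.total_nonneg
  have hHdef : T.total = ∑ i, ∑ j, η i j := rfl
  have hμ : 0 < meanDist N.loc := by
    have h1 := hshape.dist_le i₀ j₀ hij₀
    have h2 : 0 < ‖N.loc i₀ - N.loc j₀‖ := norm_pos_iff.2 (sub_ne_zero.2 (N.loc_ne hij₀))
    exact pos_of_mul_pos_right (h2.trans_le h1) hc0.le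
  have hD : ∀ i j, T.D i j ≤ c₀ * meanDist N.loc := by
    intro i j
    by_cases hij : i = j
    · rw [hij, T.D_self]; positivity
    · exact hshape.dist_le i j hij
  have hsumD : ∑ i, ∑ j, T.D i j =
      (Fintype.card (Fin n) : ℝ) * ((Fintype.card (Fin n) : ℝ) - 1) * meanDist N.loc := by
    rw [Fintype.card_fin]; exact sum_eq_meanDist N.loc (by omega)
  have hδ : ∑ i, ∑ j, T.D i j ^ 2 * T.δ i j = 0 := sum_sq_mul_stretching N.loc h hh hl
  have hq : ∀ i j, i ≠ j →
      ((Finset.univ.filter fun k => ¬ T.good i j k).card : ℝ) ≤ 2 * ε₁ * n :=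
    fun i j hij => card_not_largeAngles_le hβ hshape hij
  have hqc : 72 * c₀ * (2 * ε₁ * n) ≤ Fintype.card (Fin n) := by
    rw [Fintype.card_fin]
    rw [le_div_iff₀ (by positivity)] at h₄
    nlinarith
  have hqn : 10 * (2 * ε₁ * n) ≤ Fintype.card (Fin n) := by
    rw [Fintype.card_fin]; nlinarith
  have hcard : 2 ≤ Fintype.card (Fin n) := by rw [Fintype.card_fin]; omega
  have hdev0 := T.sum_dev_zero_le hcard hμ hc₀ hD hsumD hδ hq hqc hqn
  have hXD := T.sum_dev_sparse_le hcard hμ hc₀ hD hsumD hδ hq hqc hqn hx0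
    (adjWeight_self _) hxs hε₀.1.le (by rw [Fintype.card_fin]; exact hxrow)
  -- Three comparisons by paths: sparse graph against all edges, all pairs against all edges, and
  -- sparse graph against all pairs.
  have hW1 := sum_edges_le_of_wellDistributed h hshape.well_distributed hc₁.1.le
    (fun i j hij => (hshape.typical.codegree i j hij).1) hx0 hxs (hxg _)
  have hW2 := sum_edges_le_of_wellDistributed (x := fun _ _ => 1) (d := 2 * n * p) h
    hshape.well_distributed hc₁.1.le (fun i j hij => (hshape.typical.codegree i j hij).1)
    (fun _ _ => zero_le_one) (fun _ _ => rfl) (fun i k => by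
      simp_rw [one_mul, adjWeight_symm _ _ k]
      rw [sum_adjWeight]; exact (hshape.typical.degree k).2)
  have hW3 := sum_edges_le_of_wellDistributed h hshape.well_distributed_complete hc₁.1.le
    (fun i j hij => ncard_commonNeighbors_top hij (by omega)) hx0 hxs (hxg _)
  simp_rw [one_mul] at hW2
  rw [← hη, ← hHdef] at hW2
  rw [← hη] at hW1 hW3
  rw [← hg] at hW1 hW2
  have htop : ∑ i, ∑ j, adjWeight (⊤ : SimpleGraph (Fin n)) i j * η i j ≤ T.total :=
    Finset.sum_le_sum fun i _ => Finset.sum_le_sum fun j _ =>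
      mul_le_of_le_one_left (perpPart_nonneg _ _ _ _) (adjWeight_le_one _ _ _)
  set XB := ∑ i, ∑ j, x i j * η i j with hXB
  set GE := ∑ i, ∑ j, g i j * η i j with hGE
  set XD := ∑ i, ∑ j, x i j * T.dev 0 i j with hXDdef
  set H := T.total with hH
  have hXB0 : 0 ≤ XB := Finset.sum_nonneg fun i _ => Finset.sum_nonneg fun j _ =>
    mul_nonneg (hx0 i j) (perpPart_nonneg _ _ _ _)
  have hGE0 : 0 ≤ GE := Finset.sum_nonneg fun i _ => Finset.sum_nonneg fun j _ =>
    mul_nonneg (adjWeight_nonneg _ _ _) (perpPart_nonneg _ _ _ _)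
  have hXD' : β * XD ≤ 2 * XB + 27748 * ε₀ * c₀ ^ 3 * H := hXD
  have hdev0' : β * ∑ i, ∑ j, T.dev 0 i j ≤ 3468 * c₀ ^ 3 * H := hdev0
  have hXB4 : XB ≤ GE / 4 := by
    have hcp : 0 < n * (c₁ * p ^ 2) := mul_pos hn0 (mul_pos hc₁.1 (pow_pos hp.1 2))
    refine le_of_mul_le_mul_left ?_ hcp
    have := mul_le_mul_of_nonneg_right h₃ (mul_nonneg hn0.le hGE0)
    linarith
  have hHG : c₁ * p * H ≤ 8 * GE := by
    refine le_of_mul_le_mul_left ?_ (mul_pos hn0 hp.1)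
    linarith
  have hXBH : c₁ * XB ≤ 4 * ε₀ * H := by
    refine le_of_mul_le_mul_left ?_ hn0
    have := mul_le_mul_of_nonneg_left htop (mul_nonneg hε₀.1.le hn0.le)
    linarith
  -- The bound `h₁` absorbs the term with `27748`, and `h₂` the term `2 * XB`.
  have hstretch : XD ≤ GE / 4 := by
    rw [le_div_iff₀ (by positivity)] at h₁ h₂
    have e1 : ε₀ * c₀ ^ 3 * H * 2 ^ 22 ≤ 8 * (β * GE) := by
      have := mul_le_mul_of_nonneg_right h₁ hH0
      have := mul_le_mul_of_nonneg_left hHG hβ.1.le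
      linarith
    have e2 : 2 ^ 20 * XB ≤ 32 * (β * GE) := by
      refine le_of_mul_le_mul_left ?_ hc₁.1
      have a1 := mul_le_mul_of_nonneg_right h₂ hH0
      have a2 := mul_le_mul_of_nonneg_left hHG (mul_nonneg hβ.1.le hc₁.1.le)
      have a3 : ε₀ * H ≤ ε₀ * H * c₀ := le_mul_of_one_le_right (mul_nonneg hε₀.1.le hH0) hc₀
      linarith
    refine le_of_mul_le_mul_left ?_ hβ.1
    have : 0 ≤ β * GE := mul_nonneg hβ.1.le hGE0
    linarith
  -- If `GE = 0`, all perpendicular parts and stretchings vanish, so `h` is constant and, being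
  -- centred, zero. This gives strictness.
  have hGEpos : 0 < GE := by
    refine lt_of_le_of_ne hGE0 fun h0 => hne ?_
    have hHz : H = 0 := by
      refine le_antisymm ?_ hH0
      refine le_of_mul_le_mul_left ?_ (mul_pos hc₁.1 hp.1)
      linarith
    have hdz : ∑ i, ∑ j, T.dev 0 i j ≤ 0 := by
      refine le_of_mul_le_mul_left ?_ hβ.1
      rw [hHz] at hdev0'
      linarith
    have hall : ∑ i, ∑ j, ‖h i - h j‖ ≤ 0 := by
      calc ∑ i, ∑ j, ‖h i - h j‖ ≤ ∑ i, ∑ j, (η i j + T.dev 0 i j) :=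
            Finset.sum_le_sum fun i _ => Finset.sum_le_sum fun j _ => by
              have := norm_sub_le_perpPart_add N.loc h i j
              rw [TriangleMotion.dev, sub_zero]
              exact this
        _ = H + ∑ i, ∑ j, T.dev 0 i j := by
            simp_rw [Finset.sum_add_distrib]; rfl
        _ ≤ 0 := by linarith
    have heq : ∀ i j, h i = h j := by
      intro i j
      have h1 := (Finset.sum_eq_zero_iff_of_nonneg (fun i _ => Finset.sum_nonneg fun j _ =>
        norm_nonneg (h i - h j))).1 (le_antisymm hall (Finset.sum_nonneg fun i _ =>
          Finset.sum_nonneg fun j _ => norm_nonneg _)) i (Finset.mem_univ i)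
      have h2 := (Finset.sum_eq_zero_iff_of_nonneg (fun j _ => norm_nonneg (h i - h j))).1 h1 j
        (Finset.mem_univ j)
      exact sub_eq_zero.1 (norm_eq_zero.1 h2)
    funext i
    rw [Finset.sum_congr rfl fun j _ => heq j i, Finset.sum_const, Finset.card_univ,
      Fintype.card_fin, ← Nat.cast_smul_eq_nsmul ℝ] at hh
    exact (smul_eq_zero.1 hh).resolve_left hn0.ne'
  have hsE : GE = 2 * ∑ e ∈ N.E, η e.1 e.2 := N.sum_graph_E (perpPart_symm _ _)
  have hsB : XB = 2 * ∑ e ∈ N.EglCompl c, η e.1 e.2 := N.sum_graph_EglCompl c (perpPart_symm _ _)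
  have hsD : XD = 2 * ∑ e ∈ N.EglCompl c, T.dev 0 e.1 e.2 :=
    N.sum_graph_EglCompl c (T.dev_symm 0)
  rw [N.sum_E c] at hsE
  have hlhs : ∑ e ∈ N.EglCompl c, ‖h e.1 - h e.2‖ ≤
      ∑ e ∈ N.EglCompl c, η e.1 e.2 + ∑ e ∈ N.EglCompl c, T.dev 0 e.1 e.2 := by
    rw [← Finset.sum_add_distrib]
    refine Finset.sum_le_sum fun e _ => ?_
    have := norm_sub_le_perpPart_add N.loc h e.1 e.2
    rw [TriangleMotion.dev, sub_zero]
    exact this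
  have hrhs : ∑ e ∈ N.Egl c, ‖projPerp (N.γstar e.1 e.2) (h e.1 - h e.2)‖ =
      ∑ e ∈ N.Egl c, η e.1 e.2 := by
    refine Finset.sum_congr rfl fun e he => ?_
    rw [γstar, projPerp_direction (N.loc_ne (N.ne_of_mem_E (N.Egl_subset c he)))]
    rfl
  rw [hrhs]
  -- The exceptional edges sum to at most `(XB + XD) / 2 ≤ GE / 4`, the good long ones to `(GE - XB)
  -- / 2 ≥ 3 * GE / 8`.
  linarith

end CameraNetwork

end LUD

end

theorem theorem3 {n : ℕ} (N : LUD.CameraNetwork n)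
    -- the scale and shift solving the oracle problem, with unique scale
    (c : ℝ) (s : LUD.E3) (hcs : N.IsOracleSolution c s)
    (hunique : ∀ (c' : ℝ) (s' : LUD.E3), N.IsOracleSolution c' s' → c' = c)
    -- the parameters
    (p β ε₀ ε₁ c₀ c₁ : ℝ)
    (hp : p ∈ Set.Ioc (0 : ℝ) 1) (hβ : β ∈ Set.Ioc (0 : ℝ) 1)
    (hε₀ : ε₀ ∈ Set.Ioc (0 : ℝ) 1) (hε₁ : ε₁ ∈ Set.Ioc (0 : ℝ) 1)
    (hc₁ : c₁ ∈ Set.Ioc (0 : ℝ) 1) (hc₀ : 1 ≤ c₀)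
    (hshape : LUD.GoodShape N c p β ε₀ ε₁ c₀ c₁)
    (hε₀_le : ε₀ ≤ min (β * c₁ * p / (2 ^ 22 * c₀ ^ 3))
      (min (β * c₁ ^ 2 * p / (2 ^ 20 * c₀)) (c₁ * p ^ 2 / 16)))
    (hε₁_le : ε₁ ≤ min (1 / (144 * c₀)) (1 / 96)) :
    N.GoodLongDominance c ∧
      ∀ t : Fin n → LUD.E3, N.IsLUDSolution t ↔ ∀ i, t i = c • N.loc i + s := by
  obtain ⟨h₁, h₂₃⟩ := le_min_iff.1 hε₀_le
  obtain ⟨h₂, h₃⟩ := le_min_iff.1 h₂₃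
  obtain ⟨h₄, h₅⟩ := le_min_iff.1 hε₁_le
  have hdom := LUD.CameraNetwork.strictDominance_of_goodShape hp hβ hε₀ hc₁ hc₀ hshape
    h₁ h₂ h₃ h₄ h₅
  refine ⟨hdom.goodLongDominance, fun t => ⟨fun ht i => ?_, fun ht => ?_⟩⟩
  · by_contra hne
    have hlt := N.oracle_lt_of_strictDominance hcs hunique hdom t ht.1
      fun h => hne (congrFun h i)
    exact absurd (ht.2 _ hcs.1) (not_le.2 hlt)
  · obtain rfl : t = fun i => c • N.loc i + s := funext ht
    refine ⟨hcs.1, fun u hu => ?_⟩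
    by_cases h : u = fun i => c • N.loc i + s
    · rw [h]
    · exact (N.oracle_lt_of_strictDominance hcs hunique hdom u hu h).le
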